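/- **Setting.** Let $\mathsf X\subset\mathbb R$ and $\mathsf Y\subset\mathbb R^{k}$ be convex, $\mathsf Y$ Borel, and $\mathsf Z=\mathsf X\times\mathsf Y$. For $y\in\mathsf Y$ let $\mathbb F_y$ be a probability measure on $\mathsf Z$, measurable in $y$, and let $(Z_t)_{t\ge0}$ be a time-homogeneous $\mathsf Z$-valued Markov process with respect to a filtration $(\mathscr F_t)$, with transition kernel $P((x,y),\cdot)=\mathbb F_y$ (the next state depends on the current one only through $y$). Write $\mathbb P_z,\mathbb E_z$ for the law of the process started at $Z_0=z$. Let $r:\mathsf Z\to\mathbb R$ (exit payoff) and $c:\mathsf Y\to\mathbb R$ (flow continuation payoff) be measurable, $c(x,y):=c(y)$, and let $\beta\in(0,1)$. Put $$v^*(z)=\sup_{\tau}\mathbb E_z\Big\{\sum_{t=0}^{\tau-1}\beta^t c(Z_t)+\beta^\tau r(Z_\tau)\Big\},\qquad \psi^*(y)=c(y)+\beta\int v^*\,d\mathbb F_y,$$ where $\tau$ ranges over the almost surely finite stopping times of $(\mathscr F_t)$. For functions of $y=(y^1,\dots,y^k)$, or of $(x,y)$, $D_i$ denotes $\partial/\partial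 y^i$, $D_i^2=\partial^2/\partial(y^i)^2$, and $D_x=\partial/\partial x$. Write $\operatorname{int}$ for the interior. **Assumptions.** 1. (Drift.) There are a measurable $g:\mathsf Z\to[0,\infty)$, an integer $n\ge0$ and $m,d\ge0$ with $\beta m<1$ such that, for all $z\in\mathsf Z$, $\mathbb E_z|r(Z_n)|\le g(z)$, $\mathbb E_z|c(Z_n)|\le g(z)$ and $\mathbb E_z g(Z_1)\le m\,g(z)+d$. Moreover $m',d'>0$ are such that $m+2m'>1$, $\beta(m+2m')<1$ and $d'\ge d/(m+2m'-1)$, and the function $$\ell(z)=m'\Big(\sum_{t=1}^{n-1}\mathbb E_z|r(Z_t)|+\sum_{t=0}^{n-1}\mathbb E_z|c(Z_t)|\Big)+g(z)+d'$$ is finite on $\mathsf Z$. 2. (Density.) $\mathbb F_y(dz')=f(z'|y)\,dz'$ for all $y \in \mathsf Y$, with $f\ge0$ jointly measurable. For each $i=1,\dots,k$: $D_if(z'|y)$ and $D_i^2f(z'|y)$ exist for all $y\in\operatorname{int}(\mathsf Y)$, $z'\in\mathsf Z$; $(z',y)\mapsto D_if(z'|y)$ is continuous on $\mathsf Z\times\operatorname{int}(\mathsf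 Y)$; for fixed $z'$ and fixed $y^j$ $(j\ne i)$ the equation $D_i^2f(z'|y)=0$ has finitely many solutions $y^i$ with $y \in \operatorname{int}(\mathsf Y)$; and for each $y_0\in\operatorname{int}(\mathsf Y)$ there are $\delta>0$ and a compact $A\subset\mathsf Z$ such that, for $z'\notin A$, $D_i^2f(z'|y)\neq0$ at every $y\in\operatorname{int}(\mathsf Y)$ with $y^j=y_0^j$ $(j\ne i)$ and $|y^i-y_0^i|<\delta$. 3. (Smoothness.) For each $i$, $D_ic$ exists and is continuous on $\operatorname{int}(\mathsf Y)$. Both $r$ and $\ell$ are continuous on $\mathsf Z$, and for $\kappa\in\{r,\ell\}$ and each $i$ the function $y\mapsto\int_{\mathsf Z}|\kappa(z')D_if(z'|y)|\,dz'$ is finite and continuous on $\operatorname{int}(\mathsf Y)$. 4. (Threshold state.) For each $y\in\mathsf Y$, $x\mapsto r(x,y)$ is strictly monotone on $\mathsf X$, and there is $x\in\mathsf X$ with $r(x,y)=\psi^*(y)$. Let $\bar x:\mathsf Y\to\mathsf X$ be the decision threshold, i.e. the function with $r(\bar x(y),y)=\psi^*(y)$ for all $y\in\mathsf Y$. 5.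 $r$ is continuously differentiable on $\operatorname{int}(\mathsf Z)$, and for every $y\in\operatorname{int}(\mathsf Y)$ one has $\bar x(y)\in\operatorname{int}(\mathsf X)$ and $D_xr(\bar x(y),y)\ne0$. **Proposition.** Under these assumptions $\bar x$ is continuously differentiable on $\operatorname{int}(\mathsf Y)$, and $$D_i\bar x(y)=-\frac{D_ir(\bar x(y),y)-D_i\psi^*(y)}{D_xr(\bar x(y),y)}\qquad\text{for all } y\in\operatorname{int}(\mathsf Y),\ i=1,\dots,k.$$ -/

import Mathlib

open MeasureTheory ProbabilityTheory Set

noncomputable section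

namespace OptimalTiming

/-- `(Zₙ)` is a time-homogeneous Markov process with transition kernel `P`, relative to the
filtration `𝓕` to which it is adapted; `Pr z` is the law of the process started at `Z₀ = z`.
The field `markov` says that `P(Zₙ, B)` is a version of the conditional probability of
`{Zₙ₊₁ ∈ B}` given `𝓕ₙ`, under each `Pr z`. -/
structure IsMarkovFamily {S Ω : Type*} [MeasurableSpace S] {mΩ : MeasurableSpace Ω}
    (P : Kernel S S) (𝓕 : Filtration ℕ mΩ)
    (Z : ℕ → Ω → S) (Pr : S → Measure Ω) : Prop where
  isProbabilityMeasure : ∀ z, IsProbabilityMeasure (Pr z)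
  adapted : ∀ n, Measurable[𝓕 n] (Z n)
  initial : ∀ z, ∀ᵐ ω ∂(Pr z), Z 0 ω = z
  markov : ∀ (z : S) (n : ℕ) (A : Set Ω) (B : Set S), MeasurableSet[𝓕 n] A → MeasurableSet B →
    Pr z (A ∩ Z (n + 1) ⁻¹' B) = ∫⁻ ω in A, P (Z n ω) B ∂(Pr z)

/-- The total discounted payoff `∑_{t < k} βᵗ c(Z_t) + βᵏ r(Z_k)` along the path `ω` of an agent
who stops at `k = τ(ω)`. (The value used where `τ = ∞` is irrelevant: it only matters on a null
set.) -/
def payoff {S Ω : Type*} (r c : S → ℝ) (β : ℝ) (Z : ℕ → Ω → S) (τ : Ω → WithTop ℕ) (ω : Ω) : ℝ :=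
  (∑ t ∈ Finset.range ((τ ω).untopD 0), β ^ t * c (Z t ω))
    + β ^ ((τ ω).untopD 0) * r (Z ((τ ω).untopD 0) ω)

/-- The value function `v*(z)`: the supremum of the expected discounted payoff `𝔼_z` over all
almost surely finite stopping times of the filtration. -/
def valueFunction {S Ω : Type*} [MeasurableSpace S] {mΩ : MeasurableSpace Ω}
    (𝓕 : Filtration ℕ mΩ) (Z : ℕ → Ω → S) (Pr : S → Measure Ω)
    (r c : S → ℝ) (β : ℝ) (z : S) : ℝ :=
  sSup {a : ℝ | ∃ τ : Ω → WithTop ℕ, IsStoppingTime 𝓕 τ ∧ (∀ᵐ ω ∂(Pr z), τ ω ≠ ⊤) ∧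
    a = ∫ ω, payoff r c β Z τ ω ∂(Pr z)}

/-- The drift assumption on the (possibly unbounded) payoffs: `𝔼_z|r(Zₙ)|, 𝔼_z|c(Zₙ)| ≤ g(z)`
and `𝔼_z g(Z₁) ≤ m g(z) + d` with `β m < 1`. Here `P ^ n` is the `n`-step kernel (composition of kernels). -/
structure DriftAssumption {S : Type*} [MeasurableSpace S] (P : Kernel S S) (r c : S → ℝ) (β : ℝ)
    (g : S → ℝ) (n : ℕ) (m d : ℝ) : Prop where
  measurable_g : Measurable g
  g_nonneg : ∀ z, 0 ≤ g z
  m_nonneg : 0 ≤ m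
  d_nonneg : 0 ≤ d
  mul_lt_one : β * m < 1
  integrable_r : ∀ z, Integrable r ((P ^ n) z)
  integral_r_le : ∀ z, ∫ z', |r z'| ∂((P ^ n) z) ≤ g z
  integrable_c : ∀ z, Integrable c ((P ^ n) z)
  integral_c_le : ∀ z, ∫ z', |c z'| ∂((P ^ n) z) ≤ g z
  integrable_g : ∀ z, Integrable g (P z)
  integral_g_le : ∀ z, ∫ z', g z' ∂(P z) ≤ m * g z + d

/-- The constants `m', d'` are admissible for the weight function `ℓ`, and the expectations that
occur in `ℓ` are finite, i.e. `ℓ` is real valued. -/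
structure WeightAssumption {S : Type*} [MeasurableSpace S] (P : Kernel S S) (r c : S → ℝ) (β : ℝ)
    (n : ℕ) (m d m' d' : ℝ) : Prop where
  m'_pos : 0 < m'
  d'_pos : 0 < d'
  one_lt : 1 < m + 2 * m'
  mul_lt_one : β * (m + 2 * m') < 1
  le_d' : d / (m + 2 * m' - 1) ≤ d'
  finite_r : ∀ t ∈ Finset.Ico 1 n, ∀ z, Integrable r ((P ^ t) z)
  finite_c : ∀ t ∈ Finset.range n, ∀ z, Integrable c ((P ^ t) z)

/-- The weight function
`ℓ(z) = m' (∑_{t=1}^{n-1} 𝔼_z|r(Z_t)| + ∑_{t=0}^{n-1} 𝔼_z|c(Z_t)|) + g(z) + d'`. -/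
def weight {S : Type*} [MeasurableSpace S] (P : Kernel S S) (r c : S → ℝ)
    (g : S → ℝ) (n : ℕ) (m' d' : ℝ) (z : S) : ℝ :=
  m' * ((∑ t ∈ Finset.Ico 1 n, ∫ z', |r z'| ∂((P ^ t) z))
    + ∑ t ∈ Finset.range n, ∫ z', |c z'| ∂((P ^ t) z)) + g z + d'

/-! Threshold state problems. The threshold state lives in `X ⊆ ℝ`, the environment state in
`Y ⊆ ℝᵏ`, and the state space is the product of the two. The payoffs `r`, `c` are
given as functions on the ambient spaces, but only their values on `X × Y` and `Y` are used. -/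

/-- The `i`-th partial derivative `D_i h(y) = ∂h(y)/∂yⁱ`. -/
abbrev partialDeriv {k : ℕ} (i : Fin k) (h : EuclideanSpace ℝ (Fin k) → ℝ)
    (y : EuclideanSpace ℝ (Fin k)) : ℝ :=
  lineDeriv ℝ h y (EuclideanSpace.single i 1)

/-- The `i`-th partial derivative of `h` at `y` exists. -/
abbrev HasPartialAt {k : ℕ} (i : Fin k) (h : EuclideanSpace ℝ (Fin k) → ℝ)
    (y : EuclideanSpace ℝ (Fin k)) : Prop :=
  LineDifferentiableAt ℝ h y (EuclideanSpace.single i 1)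

/-- The exit payoff as a function on the state space. -/
abbrev exitPayoff {k : ℕ} (X : Set ℝ) (Y : Set (EuclideanSpace ℝ (Fin k)))
    (r : ℝ × EuclideanSpace ℝ (Fin k) → ℝ) (z : X × Y) : ℝ :=
  r (z.1, z.2)

/-- The flow continuation payoff, which depends on the environment only, as a function on the
state space. -/
abbrev flowPayoff {k : ℕ} (X : Set ℝ) (Y : Set (EuclideanSpace ℝ (Fin k)))
    (c : EuclideanSpace ℝ (Fin k) → ℝ) (z : X × Y) : ℝ :=
  c z.2

/-- The transition kernel `P((x, y), ·) = 𝔽_y`: the next state `(x', y')` depends on the current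
environment `y` only. -/
abbrev transition {k : ℕ} {X : Set ℝ} {Y : Set (EuclideanSpace ℝ (Fin k))}
    (F : Kernel Y (X × Y)) : Kernel (X × Y) (X × Y) :=
  F.comap Prod.snd measurable_snd

open Classical in
/-- The continuation value function `ψ*(y) = c(y) + β ∫ v*(x', y') d𝔽_y(x', y')` for `y ∈ Y`
(extended by zero outside `Y`, where it is never used). -/
def contValue {k : ℕ} {X : Set ℝ} {Y : Set (EuclideanSpace ℝ (Fin k))} {Ω : Type*}
    {mΩ : MeasurableSpace Ω} (𝓕 : Filtration ℕ mΩ)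
    (Z : ℕ → Ω → X × Y) (Pr : X × Y → Measure Ω) (F : Kernel Y (X × Y))
    (r : ℝ × EuclideanSpace ℝ (Fin k) → ℝ) (c : EuclideanSpace ℝ (Fin k) → ℝ) (β : ℝ)
    (y : EuclideanSpace ℝ (Fin k)) : ℝ :=
  if h : y ∈ Y then
    c y + β * ∫ z', valueFunction 𝓕 Z Pr (exitPayoff X Y r) (flowPayoff X Y c) β z' ∂(F ⟨y, h⟩)
  else 0

/-- Lebesgue measure on the state space `X × Y ⊆ ℝ × ℝᵏ`. -/
def lebesgue {k : ℕ} (X : Set ℝ) (Y : Set (EuclideanSpace ℝ (Fin k))) : Measure (X × Y) :=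
  (volume : Measure (ℝ × EuclideanSpace ℝ (Fin k))).comap
    fun z : X × Y => ((z.1 : ℝ), (z.2 : EuclideanSpace ℝ (Fin k)))

/-- `f(z'|y)` is a density kernel representing the transition probabilities: `f ≥ 0` is jointly
measurable and `𝔽_y(B) = ∫_B f(z'|y) dz'`, with `dz'` Lebesgue measure on `X × Y`. -/
structure IsTransitionDensity {k : ℕ} {X : Set ℝ} {Y : Set (EuclideanSpace ℝ (Fin k))}
    (F : Kernel Y (X × Y)) (f : X × Y → EuclideanSpace ℝ (Fin k) → ℝ) : Prop where
  measurable : Measurable fun p : (X × Y) × Y => f p.1 p.2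
  nonneg : ∀ z' (y : Y), 0 ≤ f z' y
  eq_withDensity : ∀ y : Y,
    F y = (lebesgue X Y).withDensity fun z' => ENNReal.ofReal (f z' y)

/-- Assumption on the density: the second partial derivatives `D_i² f(z'|y)` exist at interior
points, `D_i f` is continuous, the equation `D_i² f(z'|y) = 0` has finitely many solutions in
the `i`-th coordinate of `y` (the other coordinates and `z'` being fixed), and locally in `y` it
has no solution when `z'` is outside some compact set.
A point which differs from `y` in the `i`-th coordinate only is written `y + t eᵢ`. -/
structure DensityAssumption {k : ℕ} {X : Set ℝ} {Y : Set (EuclideanSpace ℝ (Fin k))}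
    (f : X × Y → EuclideanSpace ℝ (Fin k) → ℝ) : Prop where
  diff : ∀ (i : Fin k) (z' : X × Y), ∀ y ∈ interior Y, HasPartialAt i (f z') y
  diff₂ : ∀ (i : Fin k) (z' : X × Y), ∀ y ∈ interior Y,
    HasPartialAt i (partialDeriv i (f z')) y
  cont : ∀ i : Fin k, ContinuousOn
    (fun p : (X × Y) × EuclideanSpace ℝ (Fin k) => partialDeriv i (f p.1) p.2)
    (univ ×ˢ interior Y)
  finite_zeros : ∀ (i : Fin k) (z' : X × Y), ∀ y ∈ interior Y,
    {t : ℝ | y + t • EuclideanSpace.single i (1 : ℝ) ∈ interior Y ∧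
      partialDeriv i (partialDeriv i (f z')) (y + t • EuclideanSpace.single i (1 : ℝ)) = 0}.Finite
  zeros_escape : ∀ i : Fin k, ∀ y ∈ interior Y, ∃ δ > (0 : ℝ), ∃ A : Set (X × Y), IsCompact A ∧
    ∀ z' ∉ A, ∀ t : ℝ, |t| < δ → y + t • EuclideanSpace.single i (1 : ℝ) ∈ interior Y →
      partialDeriv i (partialDeriv i (f z')) (y + t • EuclideanSpace.single i (1 : ℝ)) ≠ 0

/-- Smoothness assumption: `D_i c` exists and is continuous on the interior of `Y`; `r` and the
weight function `ℓ` are continuous on the state space; and for both `κ = r` and `κ = ℓ` the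
function `y ↦ ∫ |κ(z') D_i f(z'|y)| dz'` is finite and continuous on the interior of `Y`. -/
structure SmoothnessAssumption {k : ℕ} {X : Set ℝ} {Y : Set (EuclideanSpace ℝ (Fin k))}
    (f : X × Y → EuclideanSpace ℝ (Fin k) → ℝ) (r : ℝ × EuclideanSpace ℝ (Fin k) → ℝ)
    (c : EuclideanSpace ℝ (Fin k) → ℝ) (ℓ : X × Y → ℝ) : Prop where
  diff_c : ∀ i : Fin k, ∀ y ∈ interior Y, HasPartialAt i c y
  cont_c : ∀ i : Fin k, ContinuousOn (partialDeriv i c) (interior Y)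
  cont : ∀ κ ∈ ({exitPayoff X Y r, ℓ} : Set (X × Y → ℝ)), Continuous κ
  integrable : ∀ κ ∈ ({exitPayoff X Y r, ℓ} : Set (X × Y → ℝ)), ∀ i : Fin k, ∀ y ∈ interior Y,
    Integrable (fun z' => κ z' * partialDeriv i (f z') y) (lebesgue X Y)
  cont_integral : ∀ κ ∈ ({exitPayoff X Y r, ℓ} : Set (X × Y → ℝ)), ∀ i : Fin k,
    ContinuousOn (fun y => ∫ z', |κ z' * partialDeriv i (f z') y| ∂(lebesgue X Y)) (interior Y)

/-- Threshold assumption: `r` is strictly monotone in the threshold state, and for every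
environment `y` some threshold state makes the agent indifferent between stopping
and continuing. -/
structure ThresholdAssumption {k : ℕ} (X : Set ℝ) (Y : Set (EuclideanSpace ℝ (Fin k)))
    (r : ℝ × EuclideanSpace ℝ (Fin k) → ℝ) (ψ : EuclideanSpace ℝ (Fin k) → ℝ) : Prop where
  strictMono : ∀ y ∈ Y, StrictMonoOn (fun x => r (x, y)) X ∨ StrictAntiOn (fun x => r (x, y)) X
  indifference : ∀ y ∈ Y, ∃ x ∈ X, r (x, y) = ψ y

/-- `xbar : Y → X` is the decision threshold: `r(xbar(y), y) = ψ(y)` for all `y ∈ Y`. -/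
def IsDecisionThreshold {k : ℕ} (X : Set ℝ) (Y : Set (EuclideanSpace ℝ (Fin k)))
    (r : ℝ × EuclideanSpace ℝ (Fin k) → ℝ) (ψ xbar : EuclideanSpace ℝ (Fin k) → ℝ) : Prop :=
  ∀ y ∈ Y, xbar y ∈ X ∧ r (xbar y, y) = ψ y

end OptimalTiming

end

namespace OptimalTiming

open scoped ENNReal Topology

/-! ### The Markov property as a family of integral identities. -/

section MarkovFamily

variable {S Ω : Type*} [MeasurableSpace S] {mΩ : MeasurableSpace Ω} {P : Kernel S S}
  {𝓕 : Filtration ℕ mΩ} {Z : ℕ → Ω → S} {Pr : S → Measure Ω}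

/-! The threshold solves `r(xbar(y), y) = ψ*(y)`, so the theorem follows from the implicit function
theorem once ψ* is C¹ on the interior of `Y`. No prior continuity of `xbar` is needed: strict
monotonicity of `r` in `x` makes `xbar(u)` the only root in `X`, so it coincides with the local
implicit function (`contDiffAt_of_unique_solution`).

For ψ*, write the expectation as `∫ v*(z') f(z'|y) dz'`. Only two facts about v* matter: it is
measurable, and `|v*| ≤ K := |r| + M ℓ`. Both come from `IsWeight.valueFunction_eq`, which
identifies v* with the countable supremum of the finite-horizon values. A supermartingale argument
and truncation of stopping times give one inequality; an optimal finite-horizon rule gives the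
other. The bound is a geometric series: by `DriftAssumption.isWeight`, ℓ grows on average by at most
`ρ = m + 2m'` per period, and `βρ < 1`.

Differentiation under the integral requires an integrable majorant of `K |D_i f|` along short
segments. Outside a compact set `D_i² f` has no zero on the segment, so `D_i f` is monotone there
(Darboux) and controlled by its endpoint values; on the compact set continuity suffices
(`DensityAssumption.exists_dominating`). The derivative `∫ v* D_i f` is continuous by Scheffé's
argument, since `K D_i f` converges pointwise together with its absolute integrals. Continuous
partial derivatives then give C¹. -/

lemma IsMarkovFamily.measurable (hZ : IsMarkovFamily P 𝓕 Z Pr) (t : ℕ) : Measurable (Z t) :=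
  (hZ.adapted t).mono (𝓕.le t) le_rfl

/-- Recasts conditional probabilities as an equality of measures, so that the integral forms of the
Markov property reduce to Fubini for `Measure.bind`. Keeping the event `A` replaces any use of
conditional expectations. -/
lemma IsMarkovFamily.map_restrict_succ (hZ : IsMarkovFamily P 𝓕 Z Pr) (z : S) (t : ℕ)
    {A : Set Ω} (hA : MeasurableSet[𝓕 t] A) :
    ((Pr z).restrict A).map (Z (t + 1)) = (((Pr z).restrict A).map (Z t)).bind P := by
  ext B hB
  rw [Measure.map_apply (hZ.measurable _) hB, Measure.restrict_apply (hZ.measurable _ hB),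
    inter_comm, hZ.markov z t A B hA hB, Measure.bind_apply hB P.aemeasurable,
    lintegral_map (P.measurable_coe hB) (hZ.measurable t)]

lemma IsMarkovFamily.setLIntegral_succ (hZ : IsMarkovFamily P 𝓕 Z Pr) (z : S) (t : ℕ)
    {A : Set Ω} (hA : MeasurableSet[𝓕 t] A) {h : S → ℝ≥0∞} (hh : Measurable h) :
    ∫⁻ ω in A, h (Z (t + 1) ω) ∂(Pr z) = ∫⁻ ω in A, ∫⁻ s, h s ∂(P (Z t ω)) ∂(Pr z) := by
  rw [← lintegral_map hh (hZ.measurable _), hZ.map_restrict_succ z t hA,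
    Measure.lintegral_bind P.aemeasurable hh.aemeasurable,
    lintegral_map hh.lintegral_kernel (hZ.measurable t)]

lemma IsMarkovFamily.lintegral_succ (hZ : IsMarkovFamily P 𝓕 Z Pr) (z : S) (t : ℕ)
    {h : S → ℝ≥0∞} (hh : Measurable h) :
    ∫⁻ ω, h (Z (t + 1) ω) ∂(Pr z) = ∫⁻ ω, ∫⁻ s, h s ∂(P (Z t ω)) ∂(Pr z) := by
  simpa using hZ.setLIntegral_succ z t MeasurableSet.univ hh

/-- A constant kernel on `Unit` stands in for the law of `Z t`, so that the composition theorems for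
kernels yield both the integrability and the identity. -/
lemma IsMarkovFamily.setIntegral_succ (hZ : IsMarkovFamily P 𝓕 Z Pr) (z : S) (t : ℕ)
    {A : Set Ω} (hA : MeasurableSet[𝓕 t] A) {h : S → ℝ} (hh : Measurable h)
    (hint : Integrable (fun ω => h (Z (t + 1) ω)) (Pr z)) :
    Integrable (fun ω => ∫ s, h s ∂(P (Z t ω))) (Pr z) ∧
    ∫ ω in A, h (Z (t + 1) ω) ∂(Pr z) = ∫ ω in A, ∫ s, h s ∂(P (Z t ω)) ∂(Pr z) := by
  have key : ∀ B : Set Ω, MeasurableSet[𝓕 t] B →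
      Integrable h ((((Pr z).restrict B).map (Z t)).bind P) := by
    intro B hB
    rw [← hZ.map_restrict_succ z t hB, integrable_map_measure hh.aestronglyMeasurable
      (hZ.measurable _).aemeasurable]
    exact hint.restrict
  have hm : StronglyMeasurable fun x => ∫ s, h s ∂(P x) := hh.stronglyMeasurable.integral_kernel
  constructor
  · have h1 := key univ MeasurableSet.univ
    rw [Measure.restrict_univ] at h1
    have h2 := Integrable.integral_comp (κ := Kernel.const Unit ((Pr z).map (Z t))) (η := P)
      (a := ()) (f := h) (by rwa [Kernel.comp_apply, Kernel.const_apply])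
    rw [Kernel.const_apply, integrable_map_measure hm.aestronglyMeasurable
      (hZ.measurable _).aemeasurable] at h2
    exact h2
  · have h3 := Kernel.integral_comp (κ := Kernel.const Unit (((Pr z).restrict A).map (Z t)))
      (η := P) (a := ()) (f := h) (by rw [Kernel.comp_apply, Kernel.const_apply]; exact key A hA)
    rw [Kernel.comp_apply, Kernel.const_apply, ← hZ.map_restrict_succ z t hA,
      integral_map (hZ.measurable _).aemeasurable hh.aestronglyMeasurable,
      integral_map (hZ.measurable _).aemeasurable hm.aestronglyMeasurable] at h3
    exact h3

end MarkovFamily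

/-! ### Weighted bounds on payoffs and on value iteration. -/

/-- A finite weight function `L` which dominates the flow payoff and the expected exit payoff one
period ahead, and which grows on average by a factor at most `ρ` per period. -/
structure IsWeight {S : Type*} [MeasurableSpace S] (P : Kernel S S) (r c : S → ℝ) (β : ℝ)
    (L : S → ℝ≥0∞) (C ρ : ℝ≥0∞) : Prop where
  measurable : Measurable L
  ne_top : ∀ z, L z ≠ ∞
  const_ne_top : C ≠ ∞
  discount_lt : ENNReal.ofReal β * ρ < 1
  growth_ne_top : ρ ≠ ∞
  flow_le : ∀ z, ‖c z‖ₑ ≤ C * L z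
  exit_le : ∀ z, ∫⁻ s, ‖r s‖ₑ ∂(P z) ≤ C * L z
  drift : ∀ z, ∫⁻ s, L s ∂(P z) ≤ ρ * L z

/-- The bound `|r| + M L` on the value function, with `M = 2C / (1 - βρ)`. -/
noncomputable def valueBound {S : Type*} (r : S → ℝ) (β : ℝ) (L : S → ℝ≥0∞) (C ρ : ℝ≥0∞)
    (z : S) : ℝ≥0∞ :=
  ‖r z‖ₑ + 2 * C * (1 - ENNReal.ofReal β * ρ)⁻¹ * L z

/-- A pathwise bound on the discounted payoff for every stopping rule. -/
noncomputable def payoffBound {S Ω : Type*} (r c : S → ℝ) (β : ℝ) (Z : ℕ → Ω → S) (ω : Ω) : ℝ≥0∞ :=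
  ‖r (Z 0 ω)‖ₑ + ∑' t : ℕ, ENNReal.ofReal β ^ t *
    (‖c (Z t ω)‖ₑ + ENNReal.ofReal β * ‖r (Z (t + 1) ω)‖ₑ)

/-- Value iteration: the value of the problem in which stopping is forced after `N` periods. -/
noncomputable def valueIter {S : Type*} [MeasurableSpace S] (P : Kernel S S) (r c : S → ℝ) (β : ℝ) :
    ℕ → S → ℝ
  | 0 => r
  | N + 1 => fun z => max (r z) (c z + β * ∫ s, valueIter P r c β N s ∂(P z))

section Bounds

/-- An exit at time `k + 1` contributes one of the terms of the series, namely the exit term with `t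
= k`; an exit at time 0 is the leading term. The bound does not depend on the stopping rule. -/
lemma enorm_payoff_le {S Ω : Type*} {Z : ℕ → Ω → S} {r c : S → ℝ} {β : ℝ} (hβ : 0 ≤ β)
    (τ : Ω → WithTop ℕ) (ω : Ω) :
    ‖payoff r c β Z τ ω‖ₑ ≤ payoffBound r c β Z ω := by
  have hb : ‖β‖ₑ = ENNReal.ofReal β := Real.enorm_of_nonneg hβ
  unfold payoff payoffBound
  generalize (τ ω).untopD 0 = k
  have key : ∀ k : ℕ, (∑ t ∈ Finset.range k, ENNReal.ofReal β ^ t * ‖c (Z t ω)‖ₑ)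
      + ENNReal.ofReal β ^ k * ‖r (Z k ω)‖ₑ ≤ ‖r (Z 0 ω)‖ₑ + ∑ t ∈ Finset.range k,
        ENNReal.ofReal β ^ t * (‖c (Z t ω)‖ₑ + ENNReal.ofReal β * ‖r (Z (t + 1) ω)‖ₑ) := by
    intro k
    rcases k with _ | k
    · simp
    · simp_rw [mul_add, Finset.sum_add_distrib]
      rw [← add_assoc, add_comm ‖r (Z 0 ω)‖ₑ, add_assoc]
      gcongr
      refine le_add_left ?_
      rw [Finset.sum_range_succ]
      refine le_add_left (le_of_eq ?_)
      rw [pow_succ]; ring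
  calc _ ≤ (∑ t ∈ Finset.range k, ENNReal.ofReal β ^ t * ‖c (Z t ω)‖ₑ)
      + ENNReal.ofReal β ^ k * ‖r (Z k ω)‖ₑ := by
        refine (enorm_add_le _ _).trans (add_le_add ((enorm_sum_le _ _).trans (le_of_eq ?_))
          (le_of_eq ?_))
        · simp [enorm_mul, enorm_pow, hb]
        · simp [enorm_mul, enorm_pow, hb]
    _ ≤ _ := (key k).trans (by gcongr; exact ENNReal.sum_le_tsum _)

variable {S Ω : Type*} [MeasurableSpace S] {mΩ : MeasurableSpace Ω} {P : Kernel S S}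
  {𝓕 : Filtration ℕ mΩ} {Z : ℕ → Ω → S} {Pr : S → Measure Ω} {r c : S → ℝ} {β : ℝ}
  {L : S → ℝ≥0∞} {C ρ : ℝ≥0∞}

lemma inv_one_sub_eq {x : ℝ≥0∞} (hx : x < 1) : (1 - x)⁻¹ = 1 + x * (1 - x)⁻¹ := by
  have h0 : (1 - x) ≠ 0 := (tsub_pos_of_lt hx).ne'
  have ht : (1 - x) ≠ ∞ := ne_top_of_le_ne_top ENNReal.one_ne_top tsub_le_self
  calc (1 - x)⁻¹ = ((1 - x) + x) * (1 - x)⁻¹ := by rw [tsub_add_cancel_of_le hx.le, one_mul]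
    _ = _ := by rw [add_mul, ENNReal.mul_inv_cancel h0 ht]

lemma IsWeight.valueBound_ne_top (hL : IsWeight P r c β L C ρ) (z : S) :
    valueBound r β L C ρ z ≠ ∞ := by
  refine ENNReal.add_ne_top.2 ⟨enorm_ne_top, ENNReal.mul_ne_top (ENNReal.mul_ne_top
    (ENNReal.mul_ne_top (by simp) hL.const_ne_top) ?_) (hL.ne_top z)⟩
  exact ENNReal.inv_ne_top.2 (tsub_pos_of_lt hL.discount_lt).ne'

/-- The bound is a supersolution of the Bellman equation. With `q = (1 - βρ)⁻¹ = 1 + βρq`, the left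
side is at most `(C + βC + 2Cβρq) L ≤ 2Cq L`; this explains the constant in `valueBound`. -/
lemma IsWeight.lintegral_valueBound_le (hL : IsWeight P r c β L C ρ) (hr : Measurable r)
    (hβ : β < 1) (z : S) :
    ‖c z‖ₑ + ENNReal.ofReal β * ∫⁻ s, valueBound r β L C ρ s ∂(P z) ≤ valueBound r β L C ρ z := by
  have hb : ENNReal.ofReal β ≤ 1 := ENNReal.ofReal_le_one.2 hβ.le
  have h := inv_one_sub_eq hL.discount_lt
  set b := ENNReal.ofReal β
  set q := (1 - b * ρ)⁻¹
  have h1 : ∫⁻ s, valueBound r β L C ρ s ∂(P z) ≤ C * L z + 2 * C * q * (ρ * L z) := by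
    unfold valueBound
    rw [lintegral_add_left hr.enorm, lintegral_const_mul _ hL.measurable]
    gcongr
    · exact hL.exit_le z
    · exact hL.drift z
  calc ‖c z‖ₑ + b * ∫⁻ s, valueBound r β L C ρ s ∂(P z)
      ≤ C * L z + b * (C * L z + 2 * C * q * (ρ * L z)) := by
        gcongr
        exact hL.flow_le z
    _ = C * L z + b * (C * L z) + 2 * C * (b * ρ * q) * L z := by ring
    _ ≤ C * L z + 1 * (C * L z) + 2 * C * (b * ρ * q) * L z := by gcongr
    _ = 2 * C * (1 + b * ρ * q) * L z := by ring
    _ = 2 * C * q * L z := by rw [← h]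
    _ ≤ _ := le_add_self

lemma IsWeight.lintegral_weight_le (hL : IsWeight P r c β L C ρ)
    (hZ : IsMarkovFamily P 𝓕 Z Pr) (z : S) (t : ℕ) :
    ∫⁻ ω, L (Z t ω) ∂(Pr z) ≤ ρ ^ t * L z := by
  induction t with
  | zero =>
    have := hZ.isProbabilityMeasure z
    have : ∫⁻ ω, L (Z 0 ω) ∂(Pr z) = ∫⁻ _, L z ∂(Pr z) :=
      lintegral_congr_ae ((hZ.initial z).mono fun ω h => by simp only [h])
    simp [this]
  | succ t ih =>
    rw [hZ.lintegral_succ z t hL.measurable]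
    calc _ ≤ ∫⁻ ω, ρ * L (Z t ω) ∂(Pr z) := lintegral_mono fun ω => hL.drift _
      _ = ρ * ∫⁻ ω, L (Z t ω) ∂(Pr z) :=
        lintegral_const_mul _ (hL.measurable.comp (hZ.measurable t))
      _ ≤ ρ * (ρ ^ t * L z) := by gcongr
      _ = _ := by ring

lemma IsWeight.lintegral_exit_succ_le (hL : IsWeight P r c β L C ρ) (hr : Measurable r)
    (hZ : IsMarkovFamily P 𝓕 Z Pr) (z : S) (t : ℕ) :
    ∫⁻ ω, ‖r (Z (t + 1) ω)‖ₑ ∂(Pr z) ≤ C * (ρ ^ t * L z) := by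
  rw [hZ.lintegral_succ z t hr.enorm]
  calc _ ≤ ∫⁻ ω, C * L (Z t ω) ∂(Pr z) := lintegral_mono fun ω => hL.exit_le _
    _ = C * ∫⁻ ω, L (Z t ω) ∂(Pr z) :=
      lintegral_const_mul _ (hL.measurable.comp (hZ.measurable t))
    _ ≤ _ := by gcongr; exact hL.lintegral_weight_le hZ z t

lemma IsWeight.lintegral_flow_le (hL : IsWeight P r c β L C ρ)
    (hZ : IsMarkovFamily P 𝓕 Z Pr) (z : S) (t : ℕ) :
    ∫⁻ ω, ‖c (Z t ω)‖ₑ ∂(Pr z) ≤ C * (ρ ^ t * L z) := by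
  calc _ ≤ ∫⁻ ω, C * L (Z t ω) ∂(Pr z) := lintegral_mono fun ω => hL.flow_le _
    _ = C * ∫⁻ ω, L (Z t ω) ∂(Pr z) :=
      lintegral_const_mul _ (hL.measurable.comp (hZ.measurable t))
    _ ≤ _ := by gcongr; exact hL.lintegral_weight_le hZ z t

lemma IsMarkovFamily.lintegral_initial (hZ : IsMarkovFamily P 𝓕 Z Pr) (z : S) (h : S → ℝ≥0∞) :
    ∫⁻ ω, h (Z 0 ω) ∂(Pr z) = h z := by
  have := hZ.isProbabilityMeasure z
  rw [lintegral_congr_ae ((hZ.initial z).mono fun ω h' => by simp only [h'] :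
    (fun ω => h (Z 0 ω)) =ᵐ[Pr z] fun _ => h z)]
  simp

lemma measurable_payoffBound (hr : Measurable r) (hc : Measurable c)
    (hZ : IsMarkovFamily P 𝓕 Z Pr) : Measurable (payoffBound r c β Z) := by
  unfold payoffBound
  exact (hr.comp (hZ.measurable 0)).enorm.add (Measurable.tsum fun t =>
    (((hc.comp (hZ.measurable t)).enorm).add
      ((hr.comp (hZ.measurable (t + 1))).enorm.const_mul _)).const_mul _)

/-- Flow and exit payoffs of period `t` each cost at most `C (βρ)ᵗ L(z)`, and the geometric series
converges. -/
lemma IsWeight.lintegral_payoffBound_le (hL : IsWeight P r c β L C ρ) (hr : Measurable r)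
    (hc : Measurable c) (hβ : β < 1) (hZ : IsMarkovFamily P 𝓕 Z Pr) (z : S) :
    ∫⁻ ω, payoffBound r c β Z ω ∂(Pr z) ≤ valueBound r β L C ρ z := by
  have hb : ENNReal.ofReal β ≤ 1 := ENNReal.ofReal_le_one.2 hβ.le
  have mr : ∀ t, Measurable fun ω => ‖r (Z t ω)‖ₑ := fun t => (hr.comp (hZ.measurable t)).enorm
  have mc : ∀ t, Measurable fun ω => ‖c (Z t ω)‖ₑ := fun t => (hc.comp (hZ.measurable t)).enorm
  have ms : ∀ t, Measurable fun ω => ‖c (Z t ω)‖ₑ + ENNReal.ofReal β * ‖r (Z (t + 1) ω)‖ₑ :=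
    fun t => (mc t).add ((mr (t + 1)).const_mul _)
  have mm : ∀ t, Measurable fun ω => ENNReal.ofReal β ^ t *
      (‖c (Z t ω)‖ₑ + ENNReal.ofReal β * ‖r (Z (t + 1) ω)‖ₑ) := fun t => (ms t).const_mul _
  unfold payoffBound valueBound
  rw [lintegral_add_left (mr 0), hZ.lintegral_initial z fun s => ‖r s‖ₑ,
    lintegral_tsum fun t => (mm t).aemeasurable]
  gcongr
  calc _ ≤ ∑' t : ℕ, (ENNReal.ofReal β * ρ) ^ t * (2 * C * L z) := by
        refine ENNReal.tsum_le_tsum fun t => ?_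
        rw [lintegral_const_mul _ (ms t),
          lintegral_add_left (mc t), lintegral_const_mul _ (mr (t + 1))]
        calc _ ≤ ENNReal.ofReal β ^ t * (C * (ρ ^ t * L z) + 1 * (C * (ρ ^ t * L z))) := by
              gcongr
              · exact hL.lintegral_flow_le hZ z t
              · exact hL.lintegral_exit_succ_le hr hZ z t
          _ = _ := by ring
    _ = _ := by
        rw [ENNReal.tsum_mul_right, ENNReal.tsum_geometric]
        ring

lemma measurable_valueIter (hr : Measurable r) (hc : Measurable c) (N : ℕ) :
    Measurable (valueIter P r c β N) := by
  induction N with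
  | zero => exact hr
  | succ N ih =>
    exact hr.max (hc.add ((ih.stronglyMeasurable.integral_kernel).measurable.const_mul β))

lemma IsWeight.enorm_valueIter_le (hL : IsWeight P r c β L C ρ) (hr : Measurable r)
    (hβ₀ : 0 ≤ β) (hβ : β < 1) (N : ℕ) (z : S) :
    ‖valueIter P r c β N z‖ₑ ≤ valueBound r β L C ρ z := by
  induction N generalizing z with
  | zero => exact le_self_add
  | succ N ih =>
    have h1 : ‖c z + β * ∫ s, valueIter P r c β N s ∂(P z)‖ₑ ≤ valueBound r β L C ρ z := by
      refine (enorm_add_le _ _).trans (le_trans ?_ (hL.lintegral_valueBound_le hr hβ z))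
      rw [enorm_mul, Real.enorm_of_nonneg hβ₀]
      gcongr
      exact (enorm_integral_le_lintegral_enorm _).trans (lintegral_mono fun s => ih s)
    rcases max_choice (r z) (c z + β * ∫ s, valueIter P r c β N s ∂(P z)) with h | h
    · change ‖max _ _‖ₑ ≤ _
      rw [h]; exact le_self_add
    · change ‖max _ _‖ₑ ≤ _
      rw [h]; exact h1

lemma IsWeight.lintegral_valueBound_ne_top (hL : IsWeight P r c β L C ρ) (hr : Measurable r)
    (hZ : IsMarkovFamily P 𝓕 Z Pr) (z : S) (t : ℕ) :
    ∫⁻ ω, valueBound r β L C ρ (Z t ω) ∂(Pr z) ≠ ∞ := by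
  rcases t with _ | t
  · rw [hZ.lintegral_initial z (valueBound r β L C ρ)]
    exact hL.valueBound_ne_top z
  · unfold valueBound
    have mr : Measurable fun ω => ‖r (Z (t + 1) ω)‖ₑ := (hr.comp (hZ.measurable _)).enorm
    have mL : Measurable fun ω => L (Z (t + 1) ω) := hL.measurable.comp (hZ.measurable _)
    rw [lintegral_add_left mr, lintegral_const_mul _ mL]
    have h2 : (1 - ENNReal.ofReal β * ρ)⁻¹ ≠ ∞ :=
      ENNReal.inv_ne_top.2 (tsub_pos_of_lt hL.discount_lt).ne'
    refine ENNReal.add_ne_top.2 ⟨ne_top_of_le_ne_top ?_ (hL.lintegral_exit_succ_le hr hZ z t),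
      ENNReal.mul_ne_top (ENNReal.mul_ne_top (ENNReal.mul_ne_top (by simp) hL.const_ne_top) h2)
      (ne_top_of_le_ne_top ?_ (hL.lintegral_weight_le hZ z (t + 1)))⟩
    · exact ENNReal.mul_ne_top hL.const_ne_top (ENNReal.mul_ne_top
        (ENNReal.pow_ne_top hL.growth_ne_top) (hL.ne_top z))
    · exact ENNReal.mul_ne_top (ENNReal.pow_ne_top hL.growth_ne_top) (hL.ne_top z)

lemma IsWeight.integrable_valueIter (hL : IsWeight P r c β L C ρ) (hr : Measurable r)
    (hc : Measurable c) (hβ₀ : 0 ≤ β) (hβ : β < 1) (hZ : IsMarkovFamily P 𝓕 Z Pr) (z : S)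
    (N t : ℕ) : Integrable (fun ω => valueIter P r c β N (Z t ω)) (Pr z) := by
  refine ⟨((measurable_valueIter hr hc N).comp (hZ.measurable t)).aestronglyMeasurable, ?_⟩
  exact lt_of_le_of_lt (lintegral_mono fun ω => hL.enorm_valueIter_le hr hβ₀ hβ N _)
    (hL.lintegral_valueBound_ne_top hr hZ z t).lt_top

lemma IsWeight.integrable_flow (hL : IsWeight P r c β L C ρ) (hr : Measurable r)
    (hc : Measurable c) (hβ : β < 1) (hZ : IsMarkovFamily P 𝓕 Z Pr) (z : S)
    (t : ℕ) : Integrable (fun ω => c (Z t ω)) (Pr z) := by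
  refine ⟨(hc.comp (hZ.measurable t)).aestronglyMeasurable, ?_⟩
  exact lt_of_le_of_lt (lintegral_mono fun ω =>
    le_self_add.trans (hL.lintegral_valueBound_le hr hβ (Z t ω)))
    (hL.lintegral_valueBound_ne_top hr hZ z t).lt_top

end Bounds

/-! ### Optimal stopping: the value function as the limit of value iteration. -/

/-- Telescoping of discounted sums, frozen from time `k` on. -/
lemma sum_increments_eq (a c : ℕ → ℝ) (β : ℝ) {k N : ℕ} (hk : k ≤ N) :
    a 0 + ∑ t ∈ Finset.range N, (if t < k then β ^ t * (c t + β * a (t + 1) - a t) else 0)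
      = (∑ t ∈ Finset.range k, β ^ t * c t) + β ^ k * a k := by
  have h1 : ∑ t ∈ Finset.range N, (if t < k then β ^ t * (c t + β * a (t + 1) - a t) else 0)
      = ∑ t ∈ Finset.range k, β ^ t * (c t + β * a (t + 1) - a t) := by
    rw [← Finset.sum_filter]
    congr 1
    ext t
    simp only [Finset.mem_filter, Finset.mem_range]
    omega
  rw [h1]
  clear h1 hk
  induction k with
  | zero => simp
  | succ k ih =>
    rw [Finset.sum_range_succ, Finset.sum_range_succ, ← add_assoc, ih, pow_succ]
    ring

lemma valueIter_succ_ge {S : Type*} [MeasurableSpace S] (P : Kernel S S) (r c : S → ℝ) (β : ℝ)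
    (N : ℕ) (z : S) :
    c z + β * ∫ s, valueIter P r c β N s ∂(P z) ≤ valueIter P r c β (N + 1) z :=
  le_max_right _ _

lemma le_valueIter {S : Type*} [MeasurableSpace S] (P : Kernel S S) (r c : S → ℝ) (β : ℝ)
    (N : ℕ) (z : S) : r z ≤ valueIter P r c β N z := by
  rcases N with _ | N
  · exact le_rfl
  · exact le_max_left _ _

lemma valueIter_succ_eq {S : Type*} [MeasurableSpace S] {P : Kernel S S} {r c : S → ℝ} {β : ℝ}
    {N : ℕ} {z : S} (h : valueIter P r c β (N + 1) z ≠ r z) :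
    valueIter P r c β (N + 1) z = c z + β * ∫ s, valueIter P r c β N s ∂(P z) := by
  rcases max_choice (r z) (c z + β * ∫ s, valueIter P r c β N s ∂(P z)) with h' | h'
  · exact absurd h' h
  · exact h'

/-- The time `τ ∧ N` as a natural number. -/
def truncate {Ω : Type*} (τ : Ω → WithTop ℕ) (N : ℕ) (ω : Ω) : ℕ :=
  (min (τ ω) (WithTop.some N)).untopD 0

/-- The event that the stopping time `τ` is later than `t`. -/
def continuing {Ω : Type*} (τ : Ω → WithTop ℕ) (t : ℕ) : Set Ω := {ω | WithTop.some t < τ ω}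

lemma coe_truncate {Ω : Type*} (τ : Ω → WithTop ℕ) (N : ℕ) (ω : Ω) :
    WithTop.some (truncate τ N ω) = min (τ ω) (WithTop.some N) := by
  unfold truncate
  cases τ ω with
  | top => rw [min_eq_right le_top]; rfl
  | coe a => rw [← WithTop.coe_min]; rfl

lemma truncate_le {Ω : Type*} (τ : Ω → WithTop ℕ) (N : ℕ) (ω : Ω) : truncate τ N ω ≤ N := by
  rw [← WithTop.coe_le_coe, coe_truncate]
  exact min_le_right _ _

lemma lt_truncate_iff {Ω : Type*} (τ : Ω → WithTop ℕ) {t N : ℕ} (ht : t < N) (ω : Ω) :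
    t < truncate τ N ω ↔ ω ∈ continuing τ t := by
  rw [← WithTop.coe_lt_coe, coe_truncate, lt_min_iff]
  exact and_iff_left (WithTop.coe_lt_coe.2 ht)

lemma payoff_min_eq {S Ω : Type*} {r c : S → ℝ} {β : ℝ} {Z : ℕ → Ω → S} (τ : Ω → WithTop ℕ)
    (N : ℕ) (ω : Ω) :
    payoff r c β Z (fun ω => min (τ ω) (WithTop.some N)) ω
      = (∑ t ∈ Finset.range (truncate τ N ω), β ^ t * c (Z t ω))
        + β ^ (truncate τ N ω) * r (Z (truncate τ N ω) ω) := rfl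

lemma tendsto_payoff_min {S Ω : Type*} {r c : S → ℝ} {β : ℝ} {Z : ℕ → Ω → S}
    {τ : Ω → WithTop ℕ} {ω : Ω} (h : τ ω ≠ ⊤) :
    Filter.Tendsto (fun N : ℕ => payoff r c β Z (fun ω => min (τ ω) (WithTop.some N)) ω)
      Filter.atTop (𝓝 (payoff r c β Z τ ω)) := by
  obtain ⟨k, hk⟩ := WithTop.ne_top_iff_exists.1 h
  refine tendsto_const_nhds.congr' ?_
  filter_upwards [Filter.eventually_ge_atTop k] with N hN
  have : min (τ ω) (WithTop.some N) = τ ω := by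
    rw [← hk]; exact min_eq_left (WithTop.coe_le_coe.2 hN)
  simp only [payoff, this]

section Optimal

variable {S Ω : Type*} [MeasurableSpace S] {mΩ : MeasurableSpace Ω} {P : Kernel S S}
  {𝓕 : Filtration ℕ mΩ} {Z : ℕ → Ω → S} {Pr : S → Measure Ω} {r c : S → ℝ} {β : ℝ}
  {L : S → ℝ≥0∞} {C ρ : ℝ≥0∞}

/-- The increment at time `t < N` of the discounted value process with horizon `N`. -/
noncomputable def valueIncrement (P : Kernel S S) (r c : S → ℝ) (β : ℝ) (Z : ℕ → Ω → S)
    (N t : ℕ) (ω : Ω) : ℝ :=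
  β ^ t * (c (Z t ω) + β * valueIter P r c β (N - (t + 1)) (Z (t + 1) ω)
    - valueIter P r c β (N - t) (Z t ω))

/-- Expresses the value process stopped at `τ ∧ N` as a sum over deterministic times, with the event
`t < τ`, known at time `t`, as indicator. The Markov property then applies term by term. -/
lemma valueProcess_eq (τ : Ω → WithTop ℕ) (N : ℕ) (ω : Ω) :
    valueIter P r c β N (Z 0 ω) + ∑ t ∈ Finset.range N,
        (continuing τ t).indicator (valueIncrement P r c β Z N t) ω
      = (∑ t ∈ Finset.range (truncate τ N ω), β ^ t * c (Z t ω))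
        + β ^ (truncate τ N ω) *
          valueIter P r c β (N - truncate τ N ω) (Z (truncate τ N ω) ω) := by
  rw [← sum_increments_eq (fun t => valueIter P r c β (N - t) (Z t ω)) (fun t => c (Z t ω)) β
    (truncate_le τ N ω)]
  refine congrArg₂ _ rfl (Finset.sum_congr rfl fun t ht => ?_)
  rw [Finset.mem_range] at ht
  by_cases h : t < truncate τ N ω
  · rw [if_pos h, indicator_of_mem ((lt_truncate_iff τ ht ω).1 h)]
    rfl
  · rw [if_neg h, indicator_of_notMem fun h' => h ((lt_truncate_iff τ ht ω).2 h')]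

lemma measurableSet_lt_stopping {τ : Ω → WithTop ℕ} (hτ : IsStoppingTime 𝓕 τ) (t : ℕ) :
    MeasurableSet[𝓕 t] (continuing τ t) :=
  hτ.measurableSet_gt t

lemma IsWeight.integrable_valueIncrement (hL : IsWeight P r c β L C ρ) (hr : Measurable r)
    (hc : Measurable c) (hβ₀ : 0 ≤ β) (hβ : β < 1) (hZ : IsMarkovFamily P 𝓕 Z Pr) (z : S)
    (N t : ℕ) : Integrable (valueIncrement P r c β Z N t) (Pr z) :=
  (((hL.integrable_flow hr hc hβ hZ z t).add
    ((hL.integrable_valueIter hr hc hβ₀ hβ hZ z _ _).const_mul β)).sub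
    (hL.integrable_valueIter hr hc hβ₀ hβ hZ z _ _)).const_mul _

lemma IsWeight.setIntegral_valueIncrement (hL : IsWeight P r c β L C ρ) (hr : Measurable r)
    (hc : Measurable c) (hβ₀ : 0 ≤ β) (hβ : β < 1) (hZ : IsMarkovFamily P 𝓕 Z Pr) (z : S)
    (N t : ℕ) {A : Set Ω} (hA : MeasurableSet[𝓕 t] A) :
    ∫ ω in A, valueIncrement P r c β Z N t ω ∂(Pr z)
      = ∫ ω in A, β ^ t * (c (Z t ω) + β * ∫ s, valueIter P r c β (N - (t + 1)) s ∂(P (Z t ω))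
          - valueIter P r c β (N - t) (Z t ω)) ∂(Pr z) := by
  have i1 := (hL.integrable_flow hr hc hβ hZ z t).restrict (s := A)
  have i2 := hL.integrable_valueIter hr hc hβ₀ hβ hZ z (N - (t + 1)) (t + 1)
  have i3 := (hL.integrable_valueIter hr hc hβ₀ hβ hZ z (N - t) t).restrict (s := A)
  have h := hZ.setIntegral_succ z t hA (measurable_valueIter hr hc (N - (t + 1))) i2
  have j2 := (i2.restrict (s := A)).const_mul β
  have j4 := (h.1.restrict (s := A)).const_mul β
  have k2 : Integrable (fun ω => c (Z t ω) + β * valueIter P r c β (N - (t + 1)) (Z (t + 1) ω))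
    ((Pr z).restrict A) := i1.add j2
  have k4 : Integrable (fun ω => c (Z t ω) +
    β * ∫ s, valueIter P r c β (N - (t + 1)) s ∂(P (Z t ω))) ((Pr z).restrict A) := i1.add j4
  unfold valueIncrement
  rw [integral_const_mul, integral_const_mul, integral_sub k2 i3, integral_sub k4 i3,
    integral_add i1 j2, integral_add i1 j4, integral_const_mul, integral_const_mul, h.2]

lemma IsMarkovFamily.integral_initial (hZ : IsMarkovFamily P 𝓕 Z Pr) (z : S) (h : S → ℝ) :
    ∫ ω, h (Z 0 ω) ∂(Pr z) = h z := by
  have := hZ.isProbabilityMeasure z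
  rw [integral_congr_ae ((hZ.initial z).mono fun ω h' => by simp only [h'] :
    (fun ω => h (Z 0 ω)) =ᵐ[Pr z] fun _ => h z)]
  simp

/-- The expected terminal value of the value process stopped at `τ ∧ N`. -/
lemma IsWeight.integral_valueProcess (hL : IsWeight P r c β L C ρ) (hr : Measurable r)
    (hc : Measurable c) (hβ₀ : 0 ≤ β) (hβ : β < 1) (hZ : IsMarkovFamily P 𝓕 Z Pr) (z : S)
    (N : ℕ) {τ : Ω → WithTop ℕ} (hτ : IsStoppingTime 𝓕 τ) :
    Integrable (fun ω => valueIter P r c β N (Z 0 ω) + ∑ t ∈ Finset.range N,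
        (continuing τ t).indicator (valueIncrement P r c β Z N t) ω) (Pr z) ∧
    ∫ ω, valueIter P r c β N (Z 0 ω) + ∑ t ∈ Finset.range N,
        (continuing τ t).indicator (valueIncrement P r c β Z N t) ω ∂(Pr z)
      = valueIter P r c β N z + ∑ t ∈ Finset.range N, ∫ ω in continuing τ t,
          β ^ t * (c (Z t ω) + β * ∫ s, valueIter P r c β (N - (t + 1)) s ∂(P (Z t ω))
          - valueIter P r c β (N - t) (Z t ω)) ∂(Pr z) := by
  have i0 := hL.integrable_valueIter hr hc hβ₀ hβ hZ z N 0
  have iτ : ∀ t : ℕ, Integrable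
      ((continuing τ t).indicator (valueIncrement P r c β Z N t)) (Pr z) := fun t =>
    (hL.integrable_valueIncrement hr hc hβ₀ hβ hZ z N t).indicator
      (𝓕.le t _ (measurableSet_lt_stopping hτ t))
  have is := integrable_finsetSum (Finset.range N) fun t _ => iτ t
  refine ⟨i0.add is, ?_⟩
  rw [integral_add i0 is, integral_finsetSum _ fun t _ => iτ t, hZ.integral_initial z]
  refine congrArg₂ _ rfl (Finset.sum_congr rfl fun t _ => ?_)
  rw [integral_indicator (𝓕.le t _ (measurableSet_lt_stopping hτ t)),
    hL.setIntegral_valueIncrement hr hc hβ₀ hβ hZ z N t (measurableSet_lt_stopping hτ t)]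

/-- The random index is removed by telescoping `βᵗ r(Z t)`: what remains is a finite sum of
measurable increments on the events `t < τ`. -/
lemma measurable_payoff_min (hr : Measurable r) (hc : Measurable c)
    (hZ : IsMarkovFamily P 𝓕 Z Pr) {τ : Ω → WithTop ℕ} (hτ : IsStoppingTime 𝓕 τ) (N : ℕ) :
    Measurable (payoff r c β Z fun ω => min (τ ω) (WithTop.some N)) := by
  have h : (payoff r c β Z fun ω => min (τ ω) (WithTop.some N)) = fun ω => r (Z 0 ω) + ∑ t ∈ Finset.range N,
      (continuing τ t).indicator
        (fun ω => β ^ t * (c (Z t ω) + β * r (Z (t + 1) ω) - r (Z t ω))) ω := by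
    ext ω
    rw [payoff_min_eq, ← sum_increments_eq (fun t => r (Z t ω)) (fun t => c (Z t ω)) β
      (truncate_le τ N ω)]
    refine congrArg₂ _ rfl (Finset.sum_congr rfl fun t ht => ?_)
    rw [Finset.mem_range] at ht
    by_cases h : t < truncate τ N ω
    · rw [if_pos h, indicator_of_mem ((lt_truncate_iff τ ht ω).1 h)]
    · rw [if_neg h, indicator_of_notMem fun h' => h ((lt_truncate_iff τ ht ω).2 h')]
  rw [h]
  refine (hr.comp (hZ.measurable 0)).add (Finset.measurable_fun_sum _ fun t _ =>
    Measurable.indicator ?_ (𝓕.le t _ (measurableSet_lt_stopping hτ t)))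
  exact (((hc.comp (hZ.measurable t)).add ((hr.comp (hZ.measurable (t + 1))).const_mul β)).sub
    (hr.comp (hZ.measurable t))).const_mul _

lemma IsWeight.integrable_of_enorm_le_payoffBound (hL : IsWeight P r c β L C ρ)
    (hr : Measurable r) (hc : Measurable c) (hβ : β < 1)
    (hZ : IsMarkovFamily P 𝓕 Z Pr) (z : S) {h : Ω → ℝ} (hm : Measurable h)
    (hb : ∀ ω, ‖h ω‖ₑ ≤ payoffBound r c β Z ω) : Integrable h (Pr z) :=
  ⟨hm.aestronglyMeasurable, ((lintegral_mono hb).trans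
    (hL.lintegral_payoffBound_le hr hc hβ hZ z)).trans_lt (hL.valueBound_ne_top z).lt_top⟩

/-- The value process is a supermartingale, because the value dominates the continuation payoff; it
ends above the payoff, because the value dominates `r`. -/
lemma IsWeight.integral_payoff_min_le (hL : IsWeight P r c β L C ρ) (hr : Measurable r)
    (hc : Measurable c) (hβ₀ : 0 ≤ β) (hβ : β < 1) (hZ : IsMarkovFamily P 𝓕 Z Pr) (z : S)
    (N : ℕ) {τ : Ω → WithTop ℕ} (hτ : IsStoppingTime 𝓕 τ) :
    ∫ ω, payoff r c β Z (fun ω => min (τ ω) (WithTop.some N)) ω ∂(Pr z) ≤ valueIter P r c β N z := by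
  have hV := hL.integral_valueProcess hr hc hβ₀ hβ hZ z N hτ
  have h1 : ∫ ω, payoff r c β Z (fun ω => min (τ ω) (WithTop.some N)) ω ∂(Pr z)
      ≤ ∫ ω, valueIter P r c β N (Z 0 ω) + ∑ t ∈ Finset.range N,
        (continuing τ t).indicator (valueIncrement P r c β Z N t) ω ∂(Pr z) := by
    refine integral_mono (hL.integrable_of_enorm_le_payoffBound hr hc hβ hZ z
      (measurable_payoff_min hr hc hZ hτ N) (enorm_payoff_le hβ₀ _)) hV.1 fun ω => ?_
    beta_reduce
    rw [valueProcess_eq, payoff_min_eq]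
    gcongr
    exact le_valueIter P r c β _ _
  refine h1.trans (hV.2.le.trans ?_)
  refine add_le_of_nonpos_right (Finset.sum_nonpos fun t ht => ?_)
  refine integral_nonpos fun ω => ?_
  rw [Finset.mem_range] at ht
  -- Makes the truncated subtractions explicit: `j + 1` periods remain at time `t`, and `j` after
  -- one step.
  obtain ⟨j, rfl⟩ : ∃ j, N = t + 1 + j := ⟨N - (t + 1), by omega⟩
  have := valueIter_succ_ge P r c β j (Z t ω)
  rw [show t + 1 + j - (t + 1) = j by omega, show t + 1 + j - t = j + 1 by omega]
  exact mul_nonpos_of_nonneg_of_nonpos (by positivity) (by linarith)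

lemma IsWeight.bddAbove_valueIter (hL : IsWeight P r c β L C ρ) (hr : Measurable r)
    (hβ₀ : 0 ≤ β) (hβ : β < 1) (z : S) : BddAbove (range fun N => valueIter P r c β N z) := by
  refine ⟨(valueBound r β L C ρ z).toReal, ?_⟩
  rintro _ ⟨N, rfl⟩
  have h := ENNReal.toReal_mono (hL.valueBound_ne_top z) (hL.enorm_valueIter_le hr hβ₀ hβ N z)
  rw [toReal_enorm] at h
  exact (le_abs_self _).trans h

/-- Truncate to `τ ∧ N` and let `N → ∞`. Where `τ` is finite the truncated payoffs are eventually
constant, and `payoffBound` dominates all of them. -/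
lemma IsWeight.integral_payoff_le (hL : IsWeight P r c β L C ρ) (hr : Measurable r)
    (hc : Measurable c) (hβ₀ : 0 ≤ β) (hβ : β < 1) (hZ : IsMarkovFamily P 𝓕 Z Pr) (z : S)
    {τ : Ω → WithTop ℕ} (hτ : IsStoppingTime 𝓕 τ) (hfin : ∀ᵐ ω ∂(Pr z), τ ω ≠ ⊤) :
    ∫ ω, payoff r c β Z τ ω ∂(Pr z) ≤ ⨆ N, valueIter P r c β N z := by
  have hB := (hL.lintegral_payoffBound_le hr hc hβ hZ z).trans_lt (hL.valueBound_ne_top z).lt_top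
  have hBm : Measurable (payoffBound r c β Z) := measurable_payoffBound hr hc hZ
  have hlim : Filter.Tendsto
      (fun N : ℕ => ∫ ω, payoff r c β Z (fun ω => min (τ ω) (WithTop.some N)) ω ∂(Pr z)) Filter.atTop
      (𝓝 (∫ ω, payoff r c β Z τ ω ∂(Pr z))) := by
    refine tendsto_integral_of_dominated_convergence (fun ω => (payoffBound r c β Z ω).toReal)
      (fun N => (measurable_payoff_min hr hc hZ hτ N).aestronglyMeasurable)
      (integrable_toReal_of_lintegral_ne_top hBm.aemeasurable hB.ne) (fun N => ?_)
      (hfin.mono fun ω h => tendsto_payoff_min h)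
    filter_upwards [ae_lt_top hBm hB.ne] with ω hω
    rw [← toReal_enorm]
    exact ENNReal.toReal_mono hω.ne (enorm_payoff_le hβ₀ _ ω)
  refine le_of_tendsto' hlim fun N => ?_
  exact (hL.integral_payoff_min_le hr hc hβ₀ hβ hZ z N hτ).trans
    (le_ciSup (hL.bddAbove_valueIter hr hβ₀ hβ z) N)

/-- The first time at which the value with the remaining horizon equals the exit payoff. -/
lemma exists_stopping_attains (hr : Measurable r) (hc : Measurable c)
    (hZ : IsMarkovFamily P 𝓕 Z Pr) (N : ℕ) :
    ∃ τ : Ω → WithTop ℕ, IsStoppingTime 𝓕 τ ∧ ∀ ω, ∃ k ≤ N, τ ω = WithTop.some k ∧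
      valueIter P r c β (N - k) (Z k ω) = r (Z k ω) ∧
      ∀ t < k, valueIter P r c β (N - t) (Z t ω) ≠ r (Z t ω) := by
  classical
  have hex : ∀ ω, ∃ k, valueIter P r c β (N - k) (Z k ω) = r (Z k ω) := fun ω =>
    ⟨N, by rw [Nat.sub_self]; rfl⟩
  refine ⟨fun ω => WithTop.some (Nat.find (hex ω)), isStoppingTime_of_measurableSet_eq fun i => ?_,
    fun ω => ⟨Nat.find (hex ω), Nat.find_min' _ (by rw [Nat.sub_self]; rfl), rfl,
      Nat.find_spec (hex ω), fun t ht => Nat.find_min (hex ω) ht⟩⟩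
  have hE : ∀ j ≤ i, MeasurableSet[𝓕 i]
      {ω | valueIter P r c β (N - j) (Z j ω) = r (Z j ω)} := fun j hj => by
    have hZj : Measurable[𝓕 i] (Z j) := (hZ.adapted j).mono (𝓕.mono hj) le_rfl
    exact hZj (measurableSet_eq_fun (measurable_valueIter hr hc (N - j)) hr)
  have : {ω | WithTop.some (Nat.find (hex ω)) = WithTop.some i}
      = {ω | valueIter P r c β (N - i) (Z i ω) = r (Z i ω)} ∩
        ⋂ j ∈ Finset.range i, {ω | valueIter P r c β (N - j) (Z j ω) = r (Z j ω)}ᶜ := by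
    ext ω
    simp only [mem_ofPred_eq, mem_inter_iff, mem_iInter, Finset.mem_range, mem_compl_iff]
    rw [WithTop.coe_inj, Nat.find_eq_iff]
  rw [this]
  refine (hE i le_rfl).inter (Finset.measurableSet_biInter _ fun j hj => ?_)
  exact (hE j (Finset.mem_range.1 hj).le).compl

/-- Before the first time the value equals `r`, it equals the continuation payoff, so the increments
have conditional mean zero; at that time the value is the payoff collected. -/
lemma IsWeight.exists_stopping_integral_eq (hL : IsWeight P r c β L C ρ) (hr : Measurable r)
    (hc : Measurable c) (hβ₀ : 0 ≤ β) (hβ : β < 1) (hZ : IsMarkovFamily P 𝓕 Z Pr) (z : S)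
    (N : ℕ) : ∃ τ : Ω → WithTop ℕ, IsStoppingTime 𝓕 τ ∧ (∀ᵐ ω ∂(Pr z), τ ω ≠ ⊤) ∧
      valueIter P r c β N z = ∫ ω, payoff r c β Z τ ω ∂(Pr z) := by
  obtain ⟨τ, hτ, h⟩ := exists_stopping_attains (β := β) hr hc hZ N
  refine ⟨τ, hτ, Filter.Eventually.of_forall fun ω => ?_, ?_⟩
  · obtain ⟨k, -, hk, -⟩ := h ω
    rw [hk]; exact WithTop.coe_ne_top
  · have hV := (hL.integral_valueProcess hr hc hβ₀ hβ hZ z N hτ).2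
    rw [Finset.sum_eq_zero, add_zero] at hV
    · rw [← hV]
      refine integral_congr_ae (Filter.Eventually.of_forall fun ω => ?_)
      beta_reduce
      rw [valueProcess_eq]
      obtain ⟨k, hkN, hk, hk', -⟩ := h ω
      have htr : truncate τ N ω = k := by
        have := coe_truncate τ N ω
        rw [hk, min_eq_left (WithTop.coe_le_coe.2 hkN)] at this
        exact WithTop.coe_injective this
      rw [htr, hk']
      simp only [payoff, hk]
      rfl
    · intro t ht
      rw [Finset.mem_range] at ht
      refine setIntegral_eq_zero_of_forall_eq_zero fun ω hω => ?_
      obtain ⟨k, hkN, hk, -, hk'⟩ := h ω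
      have htk : t < k := by
        rw [← WithTop.coe_lt_coe, ← hk]
        exact hω
      have hne := hk' t htk
      obtain ⟨j, rfl⟩ : ∃ j, N = t + 1 + j := ⟨N - (t + 1), by omega⟩
      rw [show t + 1 + j - t = j + 1 by omega] at hne ⊢
      rw [show t + 1 + j - (t + 1) = j by omega, valueIter_succ_eq hne]
      ring

/-- The value function is the limit of value iteration. -/
theorem IsWeight.valueFunction_eq (hL : IsWeight P r c β L C ρ) (hr : Measurable r)
    (hc : Measurable c) (hβ₀ : 0 ≤ β) (hβ : β < 1) (hZ : IsMarkovFamily P 𝓕 Z Pr) (z : S) :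
    valueFunction 𝓕 Z Pr r c β z = ⨆ N, valueIter P r c β N z := by
  unfold valueFunction
  -- Each finite-horizon value is itself an element of the set, so every upper bound of the set
  -- dominates their supremum.
  refine IsLUB.csSup_eq ⟨?_, fun b hb => ciSup_le fun N => ?_⟩ ?_
  · rintro a ⟨τ, hτ, hfin, rfl⟩
    exact hL.integral_payoff_le hr hc hβ₀ hβ hZ z hτ hfin
  · exact hb (hL.exists_stopping_integral_eq hr hc hβ₀ hβ hZ z N)
  · exact ⟨_, hL.exists_stopping_integral_eq hr hc hβ₀ hβ hZ z 0⟩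

/-- A supremum over stopping times need not be measurable a priori; the countable supremum over
horizons is. -/
theorem IsWeight.measurable_valueFunction (hL : IsWeight P r c β L C ρ) (hr : Measurable r)
    (hc : Measurable c) (hβ₀ : 0 ≤ β) (hβ : β < 1) (hZ : IsMarkovFamily P 𝓕 Z Pr) :
    Measurable (valueFunction 𝓕 Z Pr r c β) := by
  rw [funext fun z => hL.valueFunction_eq hr hc hβ₀ hβ hZ z]
  exact Measurable.iSup fun N => measurable_valueIter hr hc N

theorem IsWeight.abs_valueFunction_le (hL : IsWeight P r c β L C ρ) (hr : Measurable r)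
    (hc : Measurable c) (hβ₀ : 0 ≤ β) (hβ : β < 1) (hZ : IsMarkovFamily P 𝓕 Z Pr) (z : S) :
    |valueFunction 𝓕 Z Pr r c β z| ≤ (valueBound r β L C ρ z).toReal := by
  rw [hL.valueFunction_eq hr hc hβ₀ hβ hZ z]
  have h : ∀ N, |valueIter P r c β N z| ≤ (valueBound r β L C ρ z).toReal := fun N => by
    have h := ENNReal.toReal_mono (hL.valueBound_ne_top z) (hL.enorm_valueIter_le hr hβ₀ hβ N z)
    rwa [toReal_enorm] at h
  refine abs_le.2 ⟨?_, ciSup_le fun N => (abs_le.1 (h N)).2⟩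
  exact (abs_le.1 (h 0)).1.trans (le_ciSup (hL.bddAbove_valueIter hr hβ₀ hβ z) 0)

end Optimal

/-! ### The function ℓ as a weight. -/

section Drift

variable {S : Type*} [MeasurableSpace S] {P : Kernel S S} {r c g : S → ℝ} {β : ℝ}
  {n : ℕ} {m d m' d' : ℝ}

lemma sum_Ico_shift_le (e : ℕ → ℝ≥0∞) (n : ℕ) :
    ∑ t ∈ Finset.Ico 1 n, e (t + 1) ≤ ∑ t ∈ Finset.Ico 1 n, e t + e n := by
  rcases n with _ | n
  · simp
  · rw [← Finset.sum_Ico_succ_top (by omega), Finset.sum_Ico_add' e 1 (n + 1) 1]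
    exact Finset.sum_le_sum_of_subset (Finset.Ico_subset_Ico (by omega) le_rfl)

lemma sum_range_shift_le (e : ℕ → ℝ≥0∞) (n : ℕ) :
    ∑ t ∈ Finset.range n, e (t + 1) ≤ ∑ t ∈ Finset.range n, e t + e n := by
  rw [← Finset.sum_range_succ, Finset.sum_range_succ']
  exact le_self_add

lemma lintegral_pow_zero (z : S) {h : S → ℝ≥0∞} (hh : Measurable h) :
    ∫⁻ s, h s ∂((P ^ 0) z) = h z := by
  rw [pow_zero]
  exact lintegral_dirac' z hh

lemma lintegral_lintegral_pow (t : ℕ) (z : S) {h : S → ℝ≥0∞} (hh : Measurable h) :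
    ∫⁻ x, ∫⁻ s, h s ∂((P ^ t) x) ∂(P z) = ∫⁻ s, h s ∂((P ^ (t + 1)) z) := by
  rw [pow_succ]
  exact (Kernel.lintegral_comp (P ^ t) P z hh).symm

lemma lintegral_enorm_eq_ofReal {μ : Measure S} {h : S → ℝ} (hh : Integrable h μ) :
    ∫⁻ s, ‖h s‖ₑ ∂μ = ENNReal.ofReal (∫ s, |h s| ∂μ) :=
  (ofReal_integral_norm_eq_lintegral_enorm hh).symm

/-- In extended nonnegative form ℓ can be integrated against `P` by Tonelli, without integrability
conditions. -/
lemma ofReal_weight (hdrift : DriftAssumption P r c β g n m d)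
    (hweight : WeightAssumption P r c β n m d m' d') (z : S) :
    ENNReal.ofReal (weight P r c g n m' d' z)
      = ENNReal.ofReal m' * (∑ t ∈ Finset.Ico 1 n, ∫⁻ s, ‖r s‖ₑ ∂((P ^ t) z)
        + ∑ t ∈ Finset.range n, ∫⁻ s, ‖c s‖ₑ ∂((P ^ t) z))
        + ENNReal.ofReal (g z) + ENNReal.ofReal d' := by
  have h1 : 0 ≤ ∑ t ∈ Finset.Ico 1 n, ∫ s, |r s| ∂((P ^ t) z) :=
    Finset.sum_nonneg fun t _ => integral_nonneg fun s => abs_nonneg _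
  have h2 : 0 ≤ ∑ t ∈ Finset.range n, ∫ s, |c s| ∂((P ^ t) z) :=
    Finset.sum_nonneg fun t _ => integral_nonneg fun s => abs_nonneg _
  have hm' := hweight.m'_pos.le
  have hg := hdrift.g_nonneg z
  unfold weight
  rw [ENNReal.ofReal_add (by positivity) hweight.d'_pos.le, ENNReal.ofReal_add (by positivity) hg,
    ENNReal.ofReal_mul hm', ENNReal.ofReal_add h1 h2,
    ENNReal.ofReal_sum_of_nonneg fun t _ => integral_nonneg fun s => abs_nonneg _,
    ENNReal.ofReal_sum_of_nonneg fun t _ => integral_nonneg fun s => abs_nonneg _]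
  congr 4
  · exact Finset.sum_congr rfl fun t ht =>
      (lintegral_enorm_eq_ofReal (hweight.finite_r t ht z)).symm
  · exact Finset.sum_congr rfl fun t ht =>
      (lintegral_enorm_eq_ofReal (hweight.finite_c t ht z)).symm

lemma weight_nonneg (hdrift : DriftAssumption P r c β g n m d)
    (hweight : WeightAssumption P r c β n m d m' d') (z : S) :
    0 ≤ weight P r c g n m' d' z := by
  have h1 : 0 ≤ ∑ t ∈ Finset.Ico 1 n, ∫ s, |r s| ∂((P ^ t) z) :=
    Finset.sum_nonneg fun t _ => integral_nonneg fun s => abs_nonneg _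
  have h2 : 0 ≤ ∑ t ∈ Finset.range n, ∫ s, |c s| ∂((P ^ t) z) :=
    Finset.sum_nonneg fun t _ => integral_nonneg fun s => abs_nonneg _
  have hm' := hweight.m'_pos.le
  have hd' := hweight.d'_pos.le
  have hg := hdrift.g_nonneg z
  unfold weight
  positivity

/-- The weight function grows on average by a factor at most `m + 2m'` per period. -/
lemma lintegral_weight_le (hr : Measurable r) (hc : Measurable c) [IsMarkovKernel P]
    (hdrift : DriftAssumption P r c β g n m d)
    (hweight : WeightAssumption P r c β n m d m' d') (z : S) :
    ∫⁻ s, ENNReal.ofReal (weight P r c g n m' d' s) ∂(P z)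
      ≤ ENNReal.ofReal (m + 2 * m') * ENNReal.ofReal (weight P r c g n m' d' z) := by
  have hm' := hweight.m'_pos.le
  have hm := hdrift.m_nonneg
  have mr : ∀ t, Measurable fun x => ∫⁻ s, ‖r s‖ₑ ∂((P ^ t) x) := fun t => hr.enorm.lintegral_kernel
  have mc : ∀ t, Measurable fun x => ∫⁻ s, ‖c s‖ₑ ∂((P ^ t) x) := fun t => hc.enorm.lintegral_kernel
  have mR : Measurable fun x => ∑ t ∈ Finset.Ico 1 n, ∫⁻ s, ‖r s‖ₑ ∂((P ^ t) x) :=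
    Finset.measurable_fun_sum _ fun t _ => mr t
  have mC : Measurable fun x => ∑ t ∈ Finset.range n, ∫⁻ s, ‖c s‖ₑ ∂((P ^ t) x) :=
    Finset.measurable_fun_sum _ fun t _ => mc t
  have mRC : Measurable fun x => ∑ t ∈ Finset.Ico 1 n, ∫⁻ s, ‖r s‖ₑ ∂((P ^ t) x)
    + ∑ t ∈ Finset.range n, ∫⁻ s, ‖c s‖ₑ ∂((P ^ t) x) := mR.add mC
  have mg : Measurable fun x => ENNReal.ofReal (g x) := hdrift.measurable_g.ennreal_ofReal
  simp_rw [ofReal_weight hdrift hweight]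
  rw [lintegral_add_right _ measurable_const, lintegral_add_right _ mg,
    lintegral_const_mul _ mRC, lintegral_add_right _ mC,
    lintegral_finsetSum _ fun t _ => mr t, lintegral_finsetSum _ fun t _ => mc t]
  simp_rw [lintegral_lintegral_pow _ z hr.enorm, lintegral_lintegral_pow _ z hc.enorm]
  rw [lintegral_const, measure_univ, mul_one]
  have hg : ∫⁻ x, ENNReal.ofReal (g x) ∂(P z)
      ≤ ENNReal.ofReal m * ENNReal.ofReal (g z) + ENNReal.ofReal d := by
    rw [← ofReal_integral_eq_lintegral_ofReal (hdrift.integrable_g z)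
      (Filter.Eventually.of_forall hdrift.g_nonneg), ← ENNReal.ofReal_mul hm,
      ← ENNReal.ofReal_add (mul_nonneg hm (hdrift.g_nonneg z)) hdrift.d_nonneg]
    exact ENNReal.ofReal_le_ofReal (hdrift.integral_g_le z)
  have hrn : ∫⁻ s, ‖r s‖ₑ ∂((P ^ n) z) ≤ ENNReal.ofReal (g z) := by
    rw [lintegral_enorm_eq_ofReal (hdrift.integrable_r z)]
    exact ENNReal.ofReal_le_ofReal (hdrift.integral_r_le z)
  have hcn : ∫⁻ s, ‖c s‖ₑ ∂((P ^ n) z) ≤ ENNReal.ofReal (g z) := by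
    rw [lintegral_enorm_eq_ofReal (hdrift.integrable_c z)]
    exact ENNReal.ofReal_le_ofReal (hdrift.integral_c_le z)
  -- One step of the chain shifts each sum by one period; the only new term is the one at time `n`,
  -- bounded by `g`. The two sums thus add `2m' g`, whence the factor `m + 2m'`.
  have hsr := sum_Ico_shift_le (fun t => ∫⁻ s, ‖r s‖ₑ ∂((P ^ t) z)) n
  have hsc := sum_range_shift_le (fun t => ∫⁻ s, ‖c s‖ₑ ∂((P ^ t) z)) n
  beta_reduce at hsr hsc
  -- The lower bound on `d'` is what absorbs the drift constant `d`.
  have hd : ENNReal.ofReal d + ENNReal.ofReal d'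
      ≤ ENNReal.ofReal (m + 2 * m') * ENNReal.ofReal d' := by
    rw [← ENNReal.ofReal_add hdrift.d_nonneg hweight.d'_pos.le, ← ENNReal.ofReal_mul (by positivity)]
    refine ENNReal.ofReal_le_ofReal ?_
    have h1 := hweight.one_lt
    have := (div_le_iff₀ (by linarith)).1 hweight.le_d'
    nlinarith
  have hρ : (1 : ℝ≥0∞) ≤ ENNReal.ofReal (m + 2 * m') := by
    rw [← ENNReal.ofReal_one]
    exact ENNReal.ofReal_le_ofReal hweight.one_lt.le
  have hρ' : ENNReal.ofReal (m + 2 * m') = ENNReal.ofReal m + 2 * ENNReal.ofReal m' := by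
    rw [ENNReal.ofReal_add hm (by positivity), ENNReal.ofReal_mul (by norm_num)]
    norm_num
  generalize ∑ t ∈ Finset.Ico 1 n, ∫⁻ s, ‖r s‖ₑ ∂((P ^ (t + 1)) z) = R₁ at *
  generalize ∑ t ∈ Finset.range n, ∫⁻ s, ‖c s‖ₑ ∂((P ^ (t + 1)) z) = C₁ at *
  generalize ∑ t ∈ Finset.Ico 1 n, ∫⁻ s, ‖r s‖ₑ ∂((P ^ t) z) = R₀ at *
  generalize ∑ t ∈ Finset.range n, ∫⁻ s, ‖c s‖ₑ ∂((P ^ t) z) = C₀ at *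
  generalize ENNReal.ofReal (g z) = G at *
  generalize ENNReal.ofReal m' = a at *
  generalize ENNReal.ofReal d = D at *
  generalize ENNReal.ofReal d' = D' at *
  calc a * (R₁ + C₁) + ∫⁻ x, ENNReal.ofReal (g x) ∂(P z) + D'
      ≤ a * ((R₀ + G) + (C₀ + G)) + (ENNReal.ofReal m * G + D) + D' := by
        gcongr
        · exact hsr.trans (by gcongr)
        · exact hsc.trans (by gcongr)
    _ = 1 * (a * (R₀ + C₀)) + (ENNReal.ofReal m + 2 * a) * G + (D + D') := by ring
    _ ≤ ENNReal.ofReal (m + 2 * m') * (a * (R₀ + C₀)) + ENNReal.ofReal (m + 2 * m') * G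
        + ENNReal.ofReal (m + 2 * m') * D' := by
        rw [← hρ']
        gcongr
    _ = _ := by ring

/-- Under the drift assumption the function `ℓ` is a weight for the optimal stopping problem. -/
theorem DriftAssumption.isWeight (hr : Measurable r) (hc : Measurable c) [IsMarkovKernel P]
    (hβ : 0 ≤ β) (hdrift : DriftAssumption P r c β g n m d)
    (hweight : WeightAssumption P r c β n m d m' d') :
    IsWeight P r c β (fun z => ENNReal.ofReal (weight P r c g n m' d' z))
      (ENNReal.ofReal m'⁻¹ + 1 + ENNReal.ofReal (m + 2 * m')) (ENNReal.ofReal (m + 2 * m')) := by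
  have hm' := hweight.m'_pos
  have hm := hdrift.m_nonneg
  have hinv : ENNReal.ofReal m'⁻¹ * ENNReal.ofReal m' = 1 := by
    rw [← ENNReal.ofReal_mul (by positivity), inv_mul_cancel₀ hm'.ne', ENNReal.ofReal_one]
  have hrn : ∀ z, ∫⁻ s, ‖r s‖ₑ ∂((P ^ n) z) ≤ ENNReal.ofReal (weight P r c g n m' d' z) := by
    intro z
    rw [lintegral_enorm_eq_ofReal (hdrift.integrable_r z), ofReal_weight hdrift hweight]
    exact (ENNReal.ofReal_le_ofReal (hdrift.integral_r_le z)).trans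
      (le_add_self.trans le_self_add)
  have hcn : ∀ z, ∫⁻ s, ‖c s‖ₑ ∂((P ^ n) z) ≤ ENNReal.ofReal (weight P r c g n m' d' z) := by
    intro z
    rw [lintegral_enorm_eq_ofReal (hdrift.integrable_c z), ofReal_weight hdrift hweight]
    exact (ENNReal.ofReal_le_ofReal (hdrift.integral_c_le z)).trans
      (le_add_self.trans le_self_add)
  have hsum : ∀ z, ∑ t ∈ Finset.Ico 1 n, ∫⁻ s, ‖r s‖ₑ ∂((P ^ t) z)
        + ∑ t ∈ Finset.range n, ∫⁻ s, ‖c s‖ₑ ∂((P ^ t) z)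
        ≤ ENNReal.ofReal m'⁻¹ * ENNReal.ofReal (weight P r c g n m' d' z) := by
    intro z
    calc _ = ENNReal.ofReal m'⁻¹ * (ENNReal.ofReal m' *
          (∑ t ∈ Finset.Ico 1 n, ∫⁻ s, ‖r s‖ₑ ∂((P ^ t) z)
            + ∑ t ∈ Finset.range n, ∫⁻ s, ‖c s‖ₑ ∂((P ^ t) z))) := by
          rw [← mul_assoc, hinv, one_mul]
      _ ≤ _ := by
          rw [ofReal_weight hdrift hweight]
          gcongr
          exact le_self_add.trans le_self_add
  -- The three summands of the constant serve three cases. `m'⁻¹`: the expectation is a term of the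
  -- sums in ℓ. `1`: it is bounded by `g` directly. `m + 2m'`: for `n = 0`, where `|r| ≤ ℓ`
  -- pointwise, the drift of ℓ bounds the exit payoff one period ahead.
  have hA : ∀ x : ℝ≥0∞, ENNReal.ofReal m'⁻¹ * x
      ≤ (ENNReal.ofReal m'⁻¹ + 1 + ENNReal.ofReal (m + 2 * m')) * x := fun x => by
    gcongr
    exact le_self_add.trans le_self_add
  have hB : ∀ x : ℝ≥0∞, x
      ≤ (ENNReal.ofReal m'⁻¹ + 1 + ENNReal.ofReal (m + 2 * m')) * x := fun x => by
    nth_rewrite 1 [← one_mul x]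
    gcongr
    exact le_add_self.trans le_self_add
  have hC : ∀ x : ℝ≥0∞, ENNReal.ofReal (m + 2 * m') * x
      ≤ (ENNReal.ofReal m'⁻¹ + 1 + ENNReal.ofReal (m + 2 * m')) * x := fun x => by
    gcongr
    exact le_add_self
  refine ⟨?_, fun z => ENNReal.ofReal_ne_top, by simp, ?_, ENNReal.ofReal_ne_top, fun z => ?_,
    fun z => ?_, lintegral_weight_le hr hc hdrift hweight⟩
  · rw [funext fun z => ofReal_weight hdrift hweight z]
    exact ((((Finset.measurable_fun_sum _ fun t _ => hr.enorm.lintegral_kernel).add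
      (Finset.measurable_fun_sum _ fun t _ => hc.enorm.lintegral_kernel)).const_mul _).add
      hdrift.measurable_g.ennreal_ofReal).add_const _
  · rw [← ENNReal.ofReal_mul hβ]
    exact ENNReal.ofReal_lt_one.2 hweight.mul_lt_one
  · rw [← lintegral_pow_zero (P := P) z hc.enorm]
    rcases Nat.eq_zero_or_pos n with h | h
    · have := hcn z
      rw [h] at this ⊢
      exact this.trans (hB _)
    · refine le_trans ?_ ((hsum z).trans (hA _))
      exact (Finset.single_le_sum (f := fun t => ∫⁻ s, ‖c s‖ₑ ∂((P ^ t) z))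
        (fun _ _ => zero_le) (Finset.mem_range.2 h)).trans le_add_self
  · rcases Nat.lt_or_ge 1 n with h | h
    · refine le_trans ?_ ((hsum z).trans (hA _))
      have h1 := Finset.single_le_sum (f := fun t => ∫⁻ s, ‖r s‖ₑ ∂((P ^ t) z))
        (fun _ _ => zero_le) (Finset.mem_Ico.2 ⟨le_rfl, h⟩)
      beta_reduce at h1
      rw [pow_one] at h1
      exact h1.trans le_self_add
    · interval_cases n
      · refine le_trans ?_ ((lintegral_weight_le hr hc hdrift hweight z).trans (hC _))
        refine lintegral_mono fun s => ?_
        have := hrn s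
        rwa [lintegral_pow_zero s hr.enorm] at this
      · have := hrn z
        rw [pow_one] at this
        exact this.trans (hB _)

end Drift

/-! ### Continuous partial derivatives imply C¹. -/

lemma hasDerivAt_line_of_hasLineDerivAt {E : Type*} [AddCommGroup E] [Module ℝ E] {h : E → ℝ}
    {D t : ℝ} {w e : E} (H : HasLineDerivAt ℝ h D (w + t • e) e) :
    HasDerivAt (fun s : ℝ => h (w + s • e)) D t := by
  have H' : HasDerivAt (fun s : ℝ => h (w + t • e + s • e)) D (t - t) := by rwa [sub_self]
  refine (H'.comp_sub_const t t).congr_of_eventuallyEq (Filter.Eventually.of_forall fun s => ?_)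
  beta_reduce
  congr 1
  rw [sub_smul]
  abel

/-- The mean value inequality for `t ↦ h(w + t e) - A t`. -/
lemma norm_line_sub_le {E : Type*} [AddCommGroup E] [Module ℝ E] {h : E → ℝ} {w e : E}
    {a A ε : ℝ} (hd : ∀ t ∈ uIcc 0 a, LineDifferentiableAt ℝ h (w + t • e) e)
    (hb : ∀ t ∈ uIcc 0 a, |lineDeriv ℝ h (w + t • e) e - A| ≤ ε) :
    |h (w + a • e) - h w - A * a| ≤ ε * |a| := by
  have H := Convex.norm_image_sub_le_of_norm_hasDerivWithin_le
    (f := fun t => h (w + t • e) - A * t) (s := uIcc 0 a) (x := 0) (y := a) (C := ε)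
    (f' := fun t => lineDeriv ℝ h (w + t • e) e - A)
    (fun t ht => ((hasDerivAt_line_of_hasLineDerivAt (hd t ht).hasLineDerivAt).sub
      (by simpa using (hasDerivAt_id t).const_mul A)).hasDerivWithinAt) hb
    (convex_uIcc 0 a) left_mem_uIcc right_mem_uIcc
  simp only [zero_smul, add_zero, mul_zero, sub_zero, Real.norm_eq_abs] at H
  rwa [sub_right_comm] at H

section Partial

variable {k : ℕ}

lemma sum_single_sub (y u : EuclideanSpace ℝ (Fin k)) :
    y + ∑ i, (u i - y i) • EuclideanSpace.single i (1 : ℝ) = u := by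
  ext j
  simp [Finset.sum_apply, Pi.single_apply]

/-- Keeps a path from `y` to `y + v` along the coordinate directions inside a ball around `y`. -/
lemma norm_partial_sum_le (v : EuclideanSpace ℝ (Fin k)) (s : Finset (Fin k)) (b : Fin k → ℝ)
    (hb : ∀ i, |b i| ≤ |v i|) :
    ‖∑ i ∈ s, b i • EuclideanSpace.single i (1 : ℝ)‖ ≤ k * ‖v‖ := by
  calc _ ≤ ∑ i ∈ s, ‖v‖ := by
        refine norm_sum_le_of_le _ fun i _ => ?_
        rw [norm_smul, PiLp.norm_single, norm_one, mul_one, Real.norm_eq_abs]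
        exact (hb i).trans (PiLp.norm_apply_le v i)
    _ = s.card * ‖v‖ := by simp
    _ ≤ _ := by
        gcongr
        simpa using s.card_le_univ

/-- A function with continuous partial derivatives is differentiable. -/
theorem hasFDerivAt_of_partialDeriv {U : Set (EuclideanSpace ℝ (Fin k))} (hU : IsOpen U)
    {h : EuclideanSpace ℝ (Fin k) → ℝ} (hd : ∀ i, ∀ y ∈ U, HasPartialAt i h y)
    (hc : ∀ i, ContinuousOn (partialDeriv i h) U) {y : EuclideanSpace ℝ (Fin k)} (hy : y ∈ U) :
    HasFDerivAt h (∑ i, partialDeriv i h y • (EuclideanSpace.proj i :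
      EuclideanSpace ℝ (Fin k) →L[ℝ] ℝ)) y := by
  rw [hasFDerivAt_iff_isLittleO_nhds_zero, Asymptotics.isLittleO_iff]
  intro η hη
  -- The `k` coordinate moves together cost at most `ε k ‖v‖`; the denominator `k + 1` also covers
  -- `k = 0`.
  set ε := η / (k + 1) with hε_def
  have hε : 0 < ε := by positivity
  have hev : ∀ᶠ w in 𝓝 y, w ∈ U ∧ ∀ i, |partialDeriv i h w - partialDeriv i h y| ≤ ε := by
    refine (hU.eventually_mem hy).and (Filter.eventually_all.2 fun i => ?_)
    have := ((hc i).continuousAt (hU.mem_nhds hy)).eventually (Metric.closedBall_mem_nhds _ hε)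
    exact this
  obtain ⟨δ, hδ, hball⟩ := Metric.eventually_nhds_iff_ball.1 hev
  have hδ' : 0 < δ / (k + 1) := by positivity
  filter_upwards [Metric.ball_mem_nhds 0 hδ'] with v hv
  rw [mem_ball_zero_iff, lt_div_iff₀ (by positivity)] at hv
  -- Induction on the set of coordinates already moved, one mean value estimate per coordinate.
  have key : ∀ s : Finset (Fin k),
      |h (y + ∑ i ∈ s, v i • EuclideanSpace.single i (1 : ℝ)) - h y
        - ∑ i ∈ s, partialDeriv i h y * v i| ≤ ε * ∑ i ∈ s, |v i| := by
    intro s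
    induction s using Finset.induction_on with
    | empty => simp
    | insert i s his ih =>
      rw [Finset.sum_insert his, Finset.sum_insert his, Finset.sum_insert his]
      set w := y + ∑ i ∈ s, v i • EuclideanSpace.single i (1 : ℝ) with hw
      have hmem : ∀ t ∈ uIcc 0 (v i), w + t • EuclideanSpace.single i (1 : ℝ)
          ∈ Metric.ball y δ := by
        intro t ht
        have htv : |t| ≤ |v i| := by
          simpa using abs_sub_left_of_mem_uIcc ht
        have h1 := norm_partial_sum_le v (insert i s) (fun j => if j = i then t else v j)
          (fun j => by
            by_cases hj : j = i
            · simp only [hj, if_true]; exact htv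
            · simp only [hj, if_false]; exact le_rfl)
        rw [Finset.sum_insert his, if_pos rfl, Finset.sum_congr rfl fun j hj => by
          rw [if_neg (ne_of_mem_of_not_mem hj his)]] at h1
        rw [mem_ball_iff_norm, hw]
        have h2 : y + ∑ i ∈ s, v i • EuclideanSpace.single i (1 : ℝ)
            + t • EuclideanSpace.single i (1 : ℝ) - y
            = t • EuclideanSpace.single i (1 : ℝ)
              + ∑ i ∈ s, v i • EuclideanSpace.single i (1 : ℝ) := by abel
        rw [h2]
        nlinarith [norm_nonneg v]
      have hstep := norm_line_sub_le (h := h) (w := w) (e := EuclideanSpace.single i (1 : ℝ))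
        (a := v i) (A := partialDeriv i h y) (ε := ε)
        (fun t ht => hd i _ (hball _ (hmem t ht)).1) (fun t ht => (hball _ (hmem t ht)).2 i)
      have h3 : y + (v i • EuclideanSpace.single i (1 : ℝ)
          + ∑ i ∈ s, v i • EuclideanSpace.single i (1 : ℝ))
          = w + v i • EuclideanSpace.single i (1 : ℝ) := by rw [hw]; abel
      rw [h3]
      calc _ = |(h (w + v i • EuclideanSpace.single i (1 : ℝ)) - h w - partialDeriv i h y * v i)
            + (h w - h y - ∑ i ∈ s, partialDeriv i h y * v i)| := by congr 1; ring
        _ ≤ ε * |v i| + ε * ∑ i ∈ s, |v i| := (abs_add_le _ _).trans (add_le_add hstep ih)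
        _ = _ := by ring
  have hfull := key Finset.univ
  have hsum := sum_single_sub y (y + v)
  simp only [PiLp.add_apply, add_sub_cancel_left] at hsum
  rw [hsum] at hfull
  rw [Real.norm_eq_abs]
  have hlin : (∑ i, partialDeriv i h y • (EuclideanSpace.proj i :
      EuclideanSpace ℝ (Fin k) →L[ℝ] ℝ)) v = ∑ i, partialDeriv i h y * v i := by
    simp
  rw [hlin]
  refine hfull.trans ?_
  have h4 : ∑ i, |v i| ≤ k * ‖v‖ := by
    calc _ ≤ ∑ _i : Fin k, ‖v‖ := Finset.sum_le_sum fun i _ => PiLp.norm_apply_le v i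
      _ = _ := by simp
  calc ε * ∑ i, |v i| ≤ ε * (k * ‖v‖) := by gcongr
    _ ≤ ε * ((k + 1) * ‖v‖) := by gcongr; linarith
    _ = η * ‖v‖ := by rw [hε_def]; field_simp

/-- A function with continuous partial derivatives on an open set is continuously
differentiable. -/
theorem contDiffOn_one_of_partialDeriv {U : Set (EuclideanSpace ℝ (Fin k))} (hU : IsOpen U)
    {h : EuclideanSpace ℝ (Fin k) → ℝ} (hd : ∀ i, ∀ y ∈ U, HasPartialAt i h y)
    (hc : ∀ i, ContinuousOn (partialDeriv i h) U) : ContDiffOn ℝ 1 h U := by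
  rw [show (1 : WithTop ℕ∞) = 0 + 1 from rfl, contDiffOn_succ_iff_fderiv_of_isOpen hU,
    contDiffOn_zero]
  have H := fun y (hy : y ∈ U) => hasFDerivAt_of_partialDeriv hU hd hc hy
  refine ⟨fun y hy => (H y hy).differentiableAt.differentiableWithinAt, by simp, ?_⟩
  refine ContinuousOn.congr (f := fun y => ∑ i, partialDeriv i h y • (EuclideanSpace.proj i :
      EuclideanSpace ℝ (Fin k) →L[ℝ] ℝ)) ?_ fun y hy => (H y hy).fderiv
  exact continuousOn_finsetSum _ fun i _ => (hc i).smul continuousOn_const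

end Partial

/-! ### Two analytic tools: Scheffé's lemma and endpoint bounds. -/

/-- Convergence of functions and of their absolute integrals implies convergence in `L¹`. -/
lemma tendsto_integral_abs_sub_of_tendsto {α ι : Type*} [MeasurableSpace α] {μ : Measure α}
    {l : Filter ι} [l.IsCountablyGenerated] {G : ι → α → ℝ} {G₀ : α → ℝ}
    (hG : ∀ᶠ i in l, Integrable (G i) μ) (hG₀ : Integrable G₀ μ)
    (hlim : ∀ x, Filter.Tendsto (fun i => G i x) l (𝓝 (G₀ x)))
    (hint : Filter.Tendsto (fun i => ∫ x, |G i x| ∂μ) l (𝓝 (∫ x, |G₀ x| ∂μ))) :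
    Filter.Tendsto (fun i => ∫ x, |G i x - G₀ x| ∂μ) l (𝓝 0) := by
  -- Scheffé's device: this combination lies between `0` and `2|G₀|`, so dominated convergence
  -- applies although the `G i` have no common majorant.
  have h1 : Filter.Tendsto (fun i => ∫ x, (|G i x| + |G₀ x| - |G i x - G₀ x|) ∂μ) l
      (𝓝 (∫ x, (|G₀ x| + |G₀ x| - |G₀ x - G₀ x|) ∂μ)) := by
    refine tendsto_integral_filter_of_dominated_convergence (fun x => 2 * |G₀ x|) ?_ ?_
      (hG₀.abs.const_mul 2) (Filter.Eventually.of_forall fun x => ?_)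
    · filter_upwards [hG] with i hi
      exact ((hi.abs.add hG₀.abs).sub (hi.sub hG₀).abs).aestronglyMeasurable
    · refine Filter.Eventually.of_forall fun i => Filter.Eventually.of_forall fun x => ?_
      rw [Real.norm_eq_abs, abs_le]
      have h2 := abs_sub (G i x) (G₀ x)
      have h3 := abs_sub_abs_le_abs_sub (G i x) (G₀ x)
      have h4 := abs_nonneg (G₀ x)
      constructor <;> linarith
    · exact ((hlim x).abs.add tendsto_const_nhds).sub ((hlim x).sub tendsto_const_nhds).abs
  have h2 : ∀ᶠ i in l, ∫ x, |G i x - G₀ x| ∂μ = ∫ x, |G i x| ∂μ + ∫ x, |G₀ x| ∂μ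
      - ∫ x, (|G i x| + |G₀ x| - |G i x - G₀ x|) ∂μ := by
    filter_upwards [hG] with i hi
    have h3 : Integrable (fun x => |G i x| + |G₀ x|) μ := hi.abs.add hG₀.abs
    have h4 : Integrable (fun x => |G i x - G₀ x|) μ := (hi.sub hG₀).abs
    rw [integral_sub h3 h4, integral_add hi.abs hG₀.abs]
    ring
  have h3 : ∫ x, (|G₀ x| + |G₀ x| - |G₀ x - G₀ x|) ∂μ = ∫ x, |G₀ x| ∂μ + ∫ x, |G₀ x| ∂μ := by
    rw [← integral_add hG₀.abs hG₀.abs]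
    simp
  rw [h3] at h1
  have h4 := (hint.add_const (∫ x, |G₀ x| ∂μ)).sub h1
  rw [sub_self] at h4
  exact h4.congr' (h2.mono fun i hi => hi.symm)

/-- A function on a symmetric interval whose derivative has no zeros is bounded by its values at
the end points. -/
lemma abs_le_endpoints_of_deriv_ne_zero {φ φ' : ℝ → ℝ} {ε : ℝ}
    (hd : ∀ t ∈ Icc (-ε) ε, HasDerivAt φ (φ' t) t) (hne : ∀ t ∈ Icc (-ε) ε, φ' t ≠ 0) {t : ℝ}
    (ht : t ∈ Icc (-ε) ε) : |φ t| ≤ |φ ε| + |φ (-ε)| := by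
  have hε : -ε ≤ ε := ht.1.trans ht.2
  have hconv : Convex ℝ (Icc (-ε) ε) := convex_Icc _ _
  have hcont : ContinuousOn φ (Icc (-ε) ε) := fun s hs => (hd s hs).continuousAt.continuousWithinAt
  have hr := right_mem_Icc.2 hε
  have hl := left_mem_Icc.2 hε
  have h1 := le_abs_self (φ ε)
  have h2 := neg_abs_le (φ ε)
  have h3 := le_abs_self (φ (-ε))
  have h4 := neg_abs_le (φ (-ε))
  have h5 := abs_nonneg (φ ε)
  have h6 := abs_nonneg (φ (-ε))
  -- Darboux: a derivative without zeros has constant sign, even if it is not continuous.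
  rcases hasDerivWithinAt_forall_lt_or_forall_gt_of_forall_ne hconv
    (fun s hs => (hd s hs).hasDerivWithinAt) hne with h | h
  · have hanti := strictAntiOn_of_deriv_neg hconv hcont fun s hs => by
      rw [(hd s (interior_subset hs)).deriv]; exact h s (interior_subset hs)
    have := hanti.antitoneOn ht hr ht.2
    have := hanti.antitoneOn hl ht ht.1
    exact abs_le.2 ⟨by linarith, by linarith⟩
  · have hmono := strictMonoOn_of_deriv_pos hconv hcont fun s hs => by
      rw [(hd s (interior_subset hs)).deriv]; exact h s (interior_subset hs)
    have := hmono.monotoneOn ht hr ht.2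
    have := hmono.monotoneOn hl ht ht.1
    exact abs_le.2 ⟨by linarith, by linarith⟩

/-! ### Differentiation under the integral sign against the density. -/

section Density

variable {k : ℕ} {X : Set ℝ} {Y : Set (EuclideanSpace ℝ (Fin k))}

lemma lebesgue_lt_top_of_isCompact (hX : MeasurableSet X) (hY : MeasurableSet Y)
    {A : Set (X × Y)} (hA : IsCompact A) : lebesgue X Y A < ∞ := by
  have he : MeasurableEmbedding
      (fun z : X × Y => ((z.1 : ℝ), (z.2 : EuclideanSpace ℝ (Fin k)))) :=
    (MeasurableEmbedding.subtype_coe hX).prodMap (MeasurableEmbedding.subtype_coe hY)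
  unfold lebesgue
  rw [he.comap_apply]
  exact (hA.image (by fun_prop)).measure_lt_top

lemma exists_segment_subset_interior {y : EuclideanSpace ℝ (Fin k)} (hy : y ∈ interior Y)
    (e : EuclideanSpace ℝ (Fin k)) {δ : ℝ} (hδ : 0 < δ) :
    ∃ ε, 0 < ε ∧ ε < δ ∧ ∀ t ∈ Icc (-ε) ε, y + t • e ∈ interior Y := by
  have hcont : ContinuousAt (fun t : ℝ => y + t • e) 0 := by fun_prop
  have h0 : interior Y ∈ 𝓝 (y + (0 : ℝ) • e) := by
    rw [zero_smul, add_zero]; exact isOpen_interior.mem_nhds hy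
  obtain ⟨η, hη, h⟩ := Metric.mem_nhds_iff.1 (hcont.preimage_mem_nhds h0)
  refine ⟨min η δ / 2, by positivity, ?_, fun t ht => h ?_⟩
  · have : 0 < min η δ := lt_min hη hδ
    linarith [min_le_right η δ]
  · have h1 : 0 < min η δ := lt_min hη hδ
    have h2 := min_le_left η δ
    rw [mem_ball_zero_iff, Real.norm_eq_abs]
    exact (abs_le.2 ht).trans_lt (by linarith)

variable {f : X × Y → EuclideanSpace ℝ (Fin k) → ℝ} {v K : X × Y → ℝ}

lemma DensityAssumption.continuous_partialDeriv (hdens : DensityAssumption f) (i : Fin k)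
    {y : EuclideanSpace ℝ (Fin k)} (hy : y ∈ interior Y) :
    Continuous fun z' => partialDeriv i (f z') y := by
  rw [← continuousOn_univ]
  exact (hdens.cont i).comp (f := fun z' => (z', y)) (by fun_prop) fun z' _ => ⟨mem_univ _, hy⟩

/-- A weighted partial derivative of the density is dominated locally uniformly along a line. -/
lemma DensityAssumption.exists_dominating (hdens : DensityAssumption f) (hX : MeasurableSet X)
    (hY : MeasurableSet Y) (hK : Continuous K) (hK₀ : ∀ z, 0 ≤ K z) (i : Fin k)
    (hKint : ∀ y ∈ interior Y, Integrable (fun z' => K z' * partialDeriv i (f z') y)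
      (lebesgue X Y)) {y : EuclideanSpace ℝ (Fin k)} (hy : y ∈ interior Y) :
    ∃ ε > (0 : ℝ), ∃ bound : X × Y → ℝ, Integrable bound (lebesgue X Y) ∧
      ∀ t ∈ Icc (-ε) ε, y + t • EuclideanSpace.single i (1 : ℝ) ∈ interior Y ∧
        ∀ z', K z' * |partialDeriv i (f z') (y + t • EuclideanSpace.single i (1 : ℝ))|
          ≤ bound z' := by
  obtain ⟨δ, hδ, A, hA, hAδ⟩ := hdens.zeros_escape i y hy
  obtain ⟨ε, hε, hεδ, hseg⟩ :=
    exists_segment_subset_interior hy (EuclideanSpace.single i (1 : ℝ)) hδ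
  set e := EuclideanSpace.single i (1 : ℝ) with he
  have hcont : ContinuousOn
      (fun p : (X × Y) × ℝ => K p.1 * partialDeriv i (f p.1) (y + p.2 • e))
      (A ×ˢ Icc (-ε) ε) := by
    refine (hK.comp continuous_fst).continuousOn.mul
      ((hdens.cont i).comp (f := fun p : (X × Y) × ℝ => (p.1, y + p.2 • e)) (by fun_prop) ?_)
    rintro ⟨z', t⟩ ⟨-, ht⟩
    exact ⟨mem_univ _, hseg t ht⟩
  obtain ⟨N, hN⟩ := (hA.prod isCompact_Icc).exists_bound_of_continuousOn hcont
  have hre : ε ∈ Icc (-ε) ε := ⟨by linarith, le_rfl⟩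
  have hle : -ε ∈ Icc (-ε) ε := ⟨le_rfl, by linarith⟩
  -- Off `A` the two endpoint values dominate, by monotonicity of `D_i f` along the segment, and
  -- each is integrable. On `A`, compact and of finite measure, a constant dominates.
  refine ⟨ε, hε, fun z' => (|K z' * partialDeriv i (f z') (y + ε • e)|
    + |K z' * partialDeriv i (f z') (y + (-ε) • e)|) + A.indicator (fun _ => |N|) z', ?_, ?_⟩
  · refine ((hKint _ (hseg ε hre)).abs.add (hKint _ (hseg (-ε) hle)).abs).add ?_
    rw [integrable_indicator_iff hA.measurableSet]
    exact integrableOn_const (lebesgue_lt_top_of_isCompact hX hY hA).ne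
  · intro t ht
    refine ⟨hseg t ht, fun z' => ?_⟩
    by_cases hz : z' ∈ A
    · have h1 := hN (z', t) ⟨hz, ht⟩
      rw [norm_mul, Real.norm_eq_abs, Real.norm_eq_abs, abs_of_nonneg (hK₀ z')] at h1
      beta_reduce
      rw [indicator_of_mem hz]
      refine (h1.trans (le_abs_self N)).trans (le_add_of_nonneg_left (by positivity))
    · have h1 := abs_le_endpoints_of_deriv_ne_zero
        (φ := fun t => partialDeriv i (f z') (y + t • e))
        (φ' := fun t => partialDeriv i (partialDeriv i (f z')) (y + t • e)) (ε := ε)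
        (fun s hs => hasDerivAt_line_of_hasLineDerivAt
          (hdens.diff₂ i z' _ (hseg s hs)).hasLineDerivAt)
        (fun s hs => hAδ z' hz s ((abs_le.2 hs).trans_lt hεδ) (hseg s hs)) ht
      beta_reduce
      rw [indicator_of_notMem hz, add_zero, abs_mul, abs_mul, abs_of_nonneg (hK₀ z'), ← mul_add]
      exact mul_le_mul_of_nonneg_left h1 (hK₀ z')

variable {F : Kernel Y (X × Y)}

lemma IsTransitionDensity.measurable_section (hf : IsTransitionDensity F f) {y}
    (hy : y ∈ Y) : Measurable fun z' => f z' y :=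
  hf.measurable.comp (f := fun z' : X × Y => (z', (⟨y, hy⟩ : Y))) (by fun_prop)

lemma IsTransitionDensity.integral_eq (hf : IsTransitionDensity F f) (v : X × Y → ℝ) {y}
    (hy : y ∈ Y) : ∫ z', v z' ∂(F ⟨y, hy⟩) = ∫ z', v z' * f z' y ∂(lebesgue X Y) := by
  rw [hf.eq_withDensity ⟨y, hy⟩, integral_withDensity_eq_integral_toReal_smul
    (hf.measurable_section hy).ennreal_ofReal (by simp)]
  refine integral_congr_ae (Filter.Eventually.of_forall fun z' => ?_)
  beta_reduce
  rw [ENNReal.toReal_ofReal (hf.nonneg z' ⟨y, hy⟩), smul_eq_mul, mul_comm]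

lemma IsTransitionDensity.integrable_mul (hf : IsTransitionDensity F f) {v : X × Y → ℝ} {y}
    (hy : y ∈ Y) (hv : Integrable v (F ⟨y, hy⟩)) :
    Integrable (fun z' => v z' * f z' y) (lebesgue X Y) := by
  rw [hf.eq_withDensity ⟨y, hy⟩, integrable_withDensity_iff_integrable_smul'
    (hf.measurable_section hy).ennreal_ofReal (by simp)] at hv
  refine hv.congr (Filter.Eventually.of_forall fun z' => ?_)
  beta_reduce
  rw [ENNReal.toReal_ofReal (hf.nonneg z' ⟨y, hy⟩), smul_eq_mul, mul_comm]

/-- Differentiation under the integral sign. -/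
lemma hasLineDerivAt_integral_density
    (hdens : DensityAssumption f) (hX : MeasurableSet X)
    (hY : MeasurableSet Y) (hK : Continuous K) (hv : Measurable v) (hvK : ∀ z, |v z| ≤ K z)
    (i : Fin k)
    (hKint : ∀ y ∈ interior Y, Integrable (fun z' => K z' * partialDeriv i (f z') y)
      (lebesgue X Y))
    (hvint : ∀ y ∈ interior Y, Integrable (fun z' => v z' * f z' y) (lebesgue X Y))
    {y : EuclideanSpace ℝ (Fin k)} (hy : y ∈ interior Y) :
    HasLineDerivAt ℝ (fun y => ∫ z', v z' * f z' y ∂(lebesgue X Y))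
      (∫ z', v z' * partialDeriv i (f z') y ∂(lebesgue X Y)) y (EuclideanSpace.single i 1) := by
  obtain ⟨ε, hε, bound, hbint, hb⟩ := hdens.exists_dominating hX hY hK
    (fun z => (abs_nonneg _).trans (hvK z)) i hKint hy
  have hnhds : Icc (-ε) ε ∈ 𝓝 (0 : ℝ) := Icc_mem_nhds (by linarith) hε
  have H := hasDerivAt_integral_of_dominated_loc_of_deriv_le (μ := lebesgue X Y) (𝕜 := ℝ)
    (F := fun t z' => v z' * f z' (y + t • EuclideanSpace.single i (1 : ℝ)))
    (F' := fun t z' => v z' * partialDeriv i (f z') (y + t • EuclideanSpace.single i (1 : ℝ)))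
    (x₀ := (0 : ℝ)) (bound := bound) hnhds ?_ ?_ ?_ ?_ hbint ?_
  · have := H.2
    rw [zero_smul, add_zero] at this
    exact this
  · filter_upwards [hnhds] with t ht
    exact (hvint _ (hb t ht).1).aestronglyMeasurable
  · rw [zero_smul, add_zero]
    exact hvint y hy
  · rw [zero_smul, add_zero]
    exact (hv.mul (hdens.continuous_partialDeriv i hy).measurable).aestronglyMeasurable
  · refine Filter.Eventually.of_forall fun z' t ht => le_trans ?_ ((hb t ht).2 z')
    rw [norm_mul, Real.norm_eq_abs, Real.norm_eq_abs]
    gcongr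
    exact hvK z'
  · refine Filter.Eventually.of_forall fun z' t ht => ?_
    exact (hasDerivAt_line_of_hasLineDerivAt
      (hdens.diff i z' _ (hb t ht).1).hasLineDerivAt).const_mul (v z')

/-- Continuity of the integral of a function dominated by `K` against `D_i f`. -/
lemma continuousOn_integral_partialDeriv (hdens : DensityAssumption f)
    (hv : Measurable v) (hvK : ∀ z, |v z| ≤ K z) (i : Fin k)
    (hKint : ∀ y ∈ interior Y, Integrable (fun z' => K z' * partialDeriv i (f z') y)
      (lebesgue X Y))
    (hKcont : ContinuousOn (fun y => ∫ z', |K z' * partialDeriv i (f z') y| ∂(lebesgue X Y))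
      (interior Y)) :
    ContinuousOn (fun y => ∫ z', v z' * partialDeriv i (f z') y ∂(lebesgue X Y))
      (interior Y) := by
  intro y hy
  have hK₀ : ∀ z, 0 ≤ K z := fun z => (abs_nonneg _).trans (hvK z)
  have hmem : ∀ᶠ u in 𝓝[interior Y] y, u ∈ interior Y := self_mem_nhdsWithin
  -- `K D_i f` converges in `L¹`. Since `|v| ≤ K`, the same estimate controls `v D_i f`, with no
  -- continuity of `v`.
  have hlim := tendsto_integral_abs_sub_of_tendsto (μ := lebesgue X Y) (l := 𝓝[interior Y] y)
    (G := fun u z' => K z' * partialDeriv i (f z') u)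
    (G₀ := fun z' => K z' * partialDeriv i (f z') y)
    (hmem.mono fun u hu => hKint u hu) (hKint y hy)
    (fun z' => by
      refine Filter.Tendsto.const_mul _ ?_
      have hc : ContinuousOn (fun u => partialDeriv i (f z') u) (interior Y) :=
        (hdens.cont i).comp (f := fun u => (z', u)) (by fun_prop) fun u hu => ⟨mem_univ _, hu⟩
      exact hc y hy)
    (hKcont y hy)
  have hvint : ∀ u ∈ interior Y,
      Integrable (fun z' => v z' * partialDeriv i (f z') u) (lebesgue X Y) := fun u hu => by
    refine (hKint u hu).mono
      (hv.mul (hdens.continuous_partialDeriv i hu).measurable).aestronglyMeasurable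
      (Filter.Eventually.of_forall fun z' => ?_)
    rw [norm_mul, norm_mul, Real.norm_eq_abs, Real.norm_eq_abs (K z'), abs_of_nonneg (hK₀ z')]
    gcongr
    exact hvK z'
  rw [ContinuousWithinAt, tendsto_iff_norm_sub_tendsto_zero]
  refine tendsto_of_tendsto_of_tendsto_of_le_of_le' tendsto_const_nhds hlim
    (Filter.Eventually.of_forall fun u => norm_nonneg _) (hmem.mono fun u hu => ?_)
  rw [← integral_sub (hvint u hu) (hvint y hy)]
  refine (norm_integral_le_integral_norm _).trans (integral_mono ((hvint u hu).sub
    (hvint y hy)).norm ((hKint u hu).sub (hKint y hy)).abs fun z' => ?_)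
  beta_reduce
  rw [← mul_sub, ← mul_sub, norm_mul, abs_mul, Real.norm_eq_abs, Real.norm_eq_abs,
    abs_of_nonneg (hK₀ z')]
  gcongr
  exact hvK z'

end Density

/-! ### Implicit functions. -/

/-- Regularity of an implicitly defined function that is known to be the only solution locally. -/
lemma contDiffAt_of_unique_solution {E : Type*} [NormedAddCommGroup E] [NormedSpace ℝ E]
    [CompleteSpace E] {Φ : E × ℝ → ℝ} {ξ : E → ℝ} {y : E} {X : Set ℝ}
    (hΦ : ContDiffAt ℝ 1 Φ (y, ξ y)) (hD : deriv (fun x => Φ (y, x)) (ξ y) ≠ 0)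
    (hX : X ∈ 𝓝 (ξ y)) (h0 : Φ (y, ξ y) = 0)
    (huniq : ∀ᶠ u in 𝓝 y, ∀ x ∈ X, Φ (u, x) = 0 → x = ξ u) : ContDiffAt ℝ 1 ξ y := by
  have hd : HasDerivAt (fun x => Φ (y, x)) (fderiv ℝ Φ (y, ξ y) (0, 1)) (ξ y) := by
    have h1 : HasFDerivAt Φ (fderiv ℝ Φ (y, ξ y)) (y, ξ y) :=
      (hΦ.differentiableAt one_ne_zero).hasFDerivAt
    exact h1.comp_hasDerivAt (ξ y) ((hasDerivAt_const (ξ y) y).prodMk (hasDerivAt_id (ξ y)))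
  rw [hd.deriv] at hD
  have hinv : (fderiv ℝ Φ (y, ξ y) ∘L ContinuousLinearMap.inr ℝ E ℝ).IsInvertible := by
    refine ⟨ContinuousLinearEquiv.unitsEquivAut ℝ (Units.mk0 _ hD), ?_⟩
    ext
    simp
  have hself := hΦ.implicitFunction_apply_self one_ne_zero hinv
  have hsmooth := hΦ.contDiffAt_implicitFunction one_ne_zero hinv
  have hsol := hΦ.eventually_apply_implicitFunction one_ne_zero hinv
  set φ := hΦ.implicitFunction one_ne_zero hinv
  refine hsmooth.congr_of_eventuallyEq ?_
  -- The continuity used is that of `φ`, not of `ξ`: near `y` its values are roots in `X`, and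
  -- uniqueness identifies them with `ξ`.
  have hmem : ∀ᶠ u in 𝓝 y, φ u ∈ X := by
    refine hsmooth.continuousAt.eventually_mem ?_
    rw [hself]; exact hX
  filter_upwards [hmem, hsol, huniq] with u h1 h2 h3
  exact (h3 _ h1 (h2.trans h0)).symm

/-- The derivative of an implicitly defined function. -/
lemma hasLineDerivAt_of_implicit {E : Type*} [NormedAddCommGroup E] [NormedSpace ℝ E]
    {r : ℝ × E → ℝ} {ψ ξ : E → ℝ} {y : E} (hr : DifferentiableAt ℝ r (ξ y, y))
    (hψ : DifferentiableAt ℝ ψ y) (hξ : DifferentiableAt ℝ ξ y)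
    (heq : ∀ᶠ u in 𝓝 y, r (ξ u, u) = ψ u) (hD : deriv (fun x => r (x, y)) (ξ y) ≠ 0) (e : E) :
    HasLineDerivAt ℝ ξ (-((lineDeriv ℝ (fun u => r (ξ y, u)) y e - lineDeriv ℝ ψ y e)
      / deriv (fun x => r (x, y)) (ξ y))) y e := by
  have hrd := hr.hasFDerivAt
  have h1 : deriv (fun x => r (x, y)) (ξ y) = fderiv ℝ r (ξ y, y) (1, 0) :=
    (hrd.comp_hasDerivAt (ξ y) ((hasDerivAt_id (ξ y)).prodMk (hasDerivAt_const (ξ y) y))).deriv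
  have h2 : lineDeriv ℝ (fun u => r (ξ y, u)) y e = fderiv ℝ r (ξ y, y) (0, e) := by
    have h3 : HasFDerivAt (fun u => r (ξ y, u))
        ((fderiv ℝ r (ξ y, y)).comp ((0 : E →L[ℝ] ℝ).prod (ContinuousLinearMap.id ℝ E))) y :=
      hrd.comp y ((hasFDerivAt_const (ξ y) y).prodMk (hasFDerivAt_id y))
    exact (h3.hasLineDerivAt e).lineDeriv
  have h4 : lineDeriv ℝ ψ y e = fderiv ℝ ψ y e := hψ.lineDeriv_eq_fderiv
  have h5 : HasFDerivAt (fun u => r (ξ u, u)) ((fderiv ℝ r (ξ y, y)).comp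
      ((fderiv ℝ ξ y).prod (ContinuousLinearMap.id ℝ E))) y :=
    HasFDerivAt.comp (f := fun u => (ξ u, u)) y hrd
      (hξ.hasFDerivAt.prodMk (hasFDerivAt_id y))
  -- Differentiates `r(ξ u, u) = ψ u` by the chain rule; evaluating at `e` gives a linear equation
  -- for the derivative of `ξ`.
  have h6 := (h5.congr_of_eventuallyEq (heq.mono fun u hu => hu.symm)).unique hψ.hasFDerivAt
  have h7 : fderiv ℝ r (ξ y, y) (fderiv ℝ ξ y e, e) = fderiv ℝ ψ y e := by
    rw [← h6]; rfl
  have h8 : (fderiv ℝ ξ y e, e) = fderiv ℝ ξ y e • ((1, 0) : ℝ × E) + (0, e) := by simp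
  rw [h8, map_add, map_smul, smul_eq_mul, ← h1, ← h2, ← h4] at h7
  convert hξ.hasFDerivAt.hasLineDerivAt e using 1
  rw [← h7]
  field_simp
  ring

/-! ### Smoothness of the continuation value and of the threshold. -/

section Threshold

variable {k : ℕ} {X : Set ℝ} {Y : Set (EuclideanSpace ℝ (Fin k))}

/-- The threshold is continuously differentiable, with the derivative given by implicit
differentiation, as soon as the continuation value is. -/
theorem threshold_contDiffOn (r : ℝ × EuclideanSpace ℝ (Fin k) → ℝ)
    (ψ xbar : EuclideanSpace ℝ (Fin k) → ℝ) (hψ : ContDiffOn ℝ 1 ψ (interior Y))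
    (hthr : ThresholdAssumption X Y r ψ)
    (hrC1 : ContDiffOn ℝ 1 r (interior (X ×ˢ Y)))
    (hxbar : IsDecisionThreshold X Y r ψ xbar)
    (hint : ∀ y ∈ interior Y, xbar y ∈ interior X)
    (hDx : ∀ y ∈ interior Y, deriv (fun x => r (x, y)) (xbar y) ≠ 0) :
    ContDiffOn ℝ 1 xbar (interior Y) ∧
      ∀ y ∈ interior Y, ∀ i : Fin k,
        HasLineDerivAt ℝ xbar
          (-((partialDeriv i (fun u => r (xbar y, u)) y - partialDeriv i ψ y)
            / deriv (fun x => r (x, y)) (xbar y)))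
          y (EuclideanSpace.single i 1) := by
  have hrat : ∀ y ∈ interior Y, ContDiffAt ℝ 1 r (xbar y, y) := fun y hy =>
    hrC1.contDiffAt (isOpen_interior.mem_nhds (by rw [interior_prod_eq]; exact ⟨hint y hy, hy⟩))
  have hψat : ∀ y ∈ interior Y, ContDiffAt ℝ 1 ψ y := fun y hy =>
    hψ.contDiffAt (isOpen_interior.mem_nhds hy)
  have hxat : ∀ y ∈ interior Y, ContDiffAt ℝ 1 xbar y := by
    intro y hy
    refine contDiffAt_of_unique_solution (Φ := fun p => r (p.2, p.1) - ψ p.1) (X := X) ?_ ?_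
      (mem_interior_iff_mem_nhds.1 (hint y hy)) ?_ ?_
    · have h1 : ContDiffAt ℝ 1 (fun p : EuclideanSpace ℝ (Fin k) × ℝ => r (p.2, p.1))
          (y, xbar y) :=
        ContDiffAt.comp (g := r) (f := fun p : EuclideanSpace ℝ (Fin k) × ℝ => (p.2, p.1))
          (y, xbar y) (hrat y hy) (contDiffAt_snd.prodMk contDiffAt_fst)
      have h2 : ContDiffAt ℝ 1 (fun p : EuclideanSpace ℝ (Fin k) × ℝ => ψ p.1) (y, xbar y) :=
        ContDiffAt.comp (g := ψ) (f := Prod.fst) (y, xbar y) (hψat y hy) contDiffAt_fst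
      exact h1.sub h2
    · simp only [deriv_sub_const]
      exact hDx y hy
    · exact sub_eq_zero.2 (hxbar y (interior_subset hy)).2
    · filter_upwards [isOpen_interior.mem_nhds hy] with u hu x hx hux
      have huY := interior_subset hu
      have hx' := hxbar u huY
      have heq : r (x, u) = r (xbar u, u) := (sub_eq_zero.1 hux).trans hx'.2.symm
      rcases hthr.strictMono u huY with h | h
      · exact h.injOn hx hx'.1 heq
      · exact h.injOn hx hx'.1 heq
  refine ⟨fun y hy => (hxat y hy).contDiffWithinAt, fun y hy i => ?_⟩
  refine hasLineDerivAt_of_implicit ((hrat y hy).differentiableAt one_ne_zero)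
    ((hψat y hy).differentiableAt one_ne_zero) ((hxat y hy).differentiableAt one_ne_zero) ?_
    (hDx y hy) _
  filter_upwards [isOpen_interior.mem_nhds hy] with u hu
  exact (hxbar u (interior_subset hu)).2

/-- The continuation value is continuously differentiable on the interior of `Y`. -/
theorem contDiffOn_contValue
    (hX : MeasurableSet X) (hYm : MeasurableSet Y) (hne : X.Nonempty)
    (F : Kernel Y (X × Y)) [IsMarkovKernel F]
    {Ω : Type*} {mΩ : MeasurableSpace Ω} (𝓕 : Filtration ℕ mΩ)
    (Z : ℕ → Ω → X × Y) (Pr : X × Y → Measure Ω)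
    (hZ : IsMarkovFamily (transition F) 𝓕 Z Pr)
    (r : ℝ × EuclideanSpace ℝ (Fin k) → ℝ) (c : EuclideanSpace ℝ (Fin k) → ℝ)
    (hr : Measurable (exitPayoff X Y r)) (hc : Measurable fun y : Y => c y)
    (β : ℝ) (hβ₀ : 0 < β) (hβ₁ : β < 1)
    (g : X × Y → ℝ) (n : ℕ) (m d m' d' : ℝ)
    (hdrift : DriftAssumption (transition F) (exitPayoff X Y r) (flowPayoff X Y c) β g n m d)
    (hweight : WeightAssumption (transition F) (exitPayoff X Y r) (flowPayoff X Y c)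
      β n m d m' d')
    (f : X × Y → EuclideanSpace ℝ (Fin k) → ℝ)
    (hf : IsTransitionDensity F f) (hdens : DensityAssumption f)
    (hsmooth : SmoothnessAssumption f r c
      (weight (transition F) (exitPayoff X Y r) (flowPayoff X Y c) g n m' d')) :
    ContDiffOn ℝ 1 (contValue 𝓕 Z Pr F r c β) (interior Y) := by
  have hc' : Measurable (flowPayoff X Y c) := hc.comp measurable_snd
  have hP : IsMarkovKernel (transition F) := inferInstance
  have hL := hdrift.isWeight hr hc' hβ₀.le hweight
  have hℓ₀ := weight_nonneg hdrift hweight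
  have hvm := hL.measurable_valueFunction hr hc' hβ₀.le hβ₁ hZ
  have hvb := hL.abs_valueFunction_le hr hc' hβ₀.le hβ₁ hZ
  have hfin := hL.valueBound_ne_top
  have hPB := hL.lintegral_valueBound_le hr hβ₁
  set ℓ := weight (transition F) (exitPayoff X Y r) (flowPayoff X Y c) g n m' d'
  set v := valueFunction 𝓕 Z Pr (exitPayoff X Y r) (flowPayoff X Y c) β with hv_def
  set B := valueBound (exitPayoff X Y r) β (fun z => ENNReal.ofReal (ℓ z))
    (ENNReal.ofReal m'⁻¹ + 1 + ENNReal.ofReal (m + 2 * m')) (ENNReal.ofReal (m + 2 * m'))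
  obtain ⟨M, hM, hBM⟩ : ∃ M : ℝ, 0 ≤ M ∧ ∀ z, (B z).toReal = |exitPayoff X Y r z| + M * ℓ z := by
    refine ⟨(2 * (ENNReal.ofReal m'⁻¹ + 1 + ENNReal.ofReal (m + 2 * m')) *
      (1 - ENNReal.ofReal β * ENNReal.ofReal (m + 2 * m'))⁻¹).toReal, ENNReal.toReal_nonneg,
      fun z => ?_⟩
    have h2 := (ENNReal.add_ne_top.1 (hfin z)).2
    change (‖exitPayoff X Y r z‖ₑ + _).toReal = _
    rw [ENNReal.toReal_add enorm_ne_top h2, ENNReal.toReal_mul, ENNReal.toReal_ofReal (hℓ₀ z),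
      toReal_enorm, Real.norm_eq_abs]
  have hmr : exitPayoff X Y r ∈ ({exitPayoff X Y r, ℓ} : Set (X × Y → ℝ)) := by simp
  have hml : ℓ ∈ ({exitPayoff X Y r, ℓ} : Set (X × Y → ℝ)) := by simp
  set K : X × Y → ℝ := fun z => |exitPayoff X Y r z| + M * ℓ z with hK_def
  have hK : Continuous K :=
    (hsmooth.cont _ hmr).abs.add ((hsmooth.cont _ hml).const_mul M)
  have hK₀ : ∀ z, 0 ≤ K z := fun z => add_nonneg (abs_nonneg _) (mul_nonneg hM (hℓ₀ z))
  have hvK : ∀ z, |v z| ≤ K z := fun z => (hvb z).trans (hBM z).le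
  -- As `K` and ℓ are nonnegative, absolute values add up exactly, so the integrability and
  -- continuity assumed for `r` and ℓ pass to `K`.
  have habs : ∀ (i : Fin k) y z', |K z' * partialDeriv i (f z') y|
      = |exitPayoff X Y r z' * partialDeriv i (f z') y|
        + M * |ℓ z' * partialDeriv i (f z') y| := by
    intro i y z'
    rw [abs_mul, abs_of_nonneg (hK₀ z'), abs_mul, abs_mul, abs_of_nonneg (hℓ₀ z')]
    ring
  have hKabs : ∀ i : Fin k, ∀ y ∈ interior Y,
      Integrable (fun z' => |K z' * partialDeriv i (f z') y|) (lebesgue X Y) := by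
    intro i y hy
    simp_rw [habs]
    exact (hsmooth.integrable _ hmr i y hy).abs.add
      ((hsmooth.integrable _ hml i y hy).abs.const_mul M)
  have hKint : ∀ i : Fin k, ∀ y ∈ interior Y,
      Integrable (fun z' => K z' * partialDeriv i (f z') y) (lebesgue X Y) := fun i y hy =>
    (integrable_norm_iff
      (hK.mul (hdens.continuous_partialDeriv i hy)).measurable.aestronglyMeasurable).1
      (hKabs i y hy)
  have hKcont : ∀ i : Fin k, ContinuousOn
      (fun y => ∫ z', |K z' * partialDeriv i (f z') y| ∂(lebesgue X Y)) (interior Y) := by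
    intro i
    refine ((hsmooth.cont_integral _ hmr i).add
      ((hsmooth.cont_integral _ hml i).const_mul M)).congr fun y hy => ?_
    simp_rw [habs]
    rw [integral_add (hsmooth.integrable _ hmr i y hy).abs
      ((hsmooth.integrable _ hml i y hy).abs.const_mul M), integral_const_mul]
    rfl
  have hvint : ∀ y ∈ interior Y, Integrable (fun z' => v z' * f z' y) (lebesgue X Y) := by
    intro y hy
    have hyY := interior_subset hy
    refine hf.integrable_mul hyY ⟨hvm.aestronglyMeasurable, ?_⟩
    -- The transition law ignores `x`, so any threshold state turns the environment `y` into a state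
    -- where the Bellman bound applies; `β > 0` then makes the integral of the bound finite.
    obtain ⟨x, hx⟩ := hne
    have h1 := hPB (⟨x, hx⟩, ⟨y, hyY⟩)
    have h2 : ∫⁻ s, B s ∂(F ⟨y, hyY⟩) ≠ ∞ := by
      intro htop
      have h3 : ENNReal.ofReal β * ∫⁻ s, B s ∂(F ⟨y, hyY⟩) ≤ B (⟨x, hx⟩, ⟨y, hyY⟩) :=
        le_add_self.trans h1
      rw [htop, ENNReal.mul_top (ENNReal.ofReal_pos.2 hβ₀).ne', top_le_iff] at h3
      exact hfin _ h3
    refine lt_of_le_of_lt (lintegral_mono fun z' => ?_) h2.lt_top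
    rw [← ENNReal.ofReal_toReal (hfin z'), Real.enorm_eq_ofReal_abs]
    exact ENNReal.ofReal_le_ofReal (hvb z')
  have hline := fun (i : Fin k) y (hy : y ∈ interior Y) =>
    hasLineDerivAt_integral_density hdens hX hYm hK hvm hvK i (hKint i) hvint hy
  have hH : ContDiffOn ℝ 1 (fun y => ∫ z', v z' * f z' y ∂(lebesgue X Y)) (interior Y) :=
    contDiffOn_one_of_partialDeriv isOpen_interior
      (fun i y hy => (hline i y hy).lineDifferentiableAt)
      (fun i => (continuousOn_integral_partialDeriv hdens hvm hvK i (hKint i) (hKcont i)).congr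
        fun y hy => (hline i y hy).lineDeriv)
  have hcC : ContDiffOn ℝ 1 c (interior Y) :=
    contDiffOn_one_of_partialDeriv isOpen_interior hsmooth.diff_c hsmooth.cont_c
  refine (hcC.add (contDiffOn_const.mul hH : ContDiffOn ℝ 1 (fun y => β * _) _)).congr
    fun y hy => ?_
  rw [contValue, dif_pos (interior_subset hy), hf.integral_eq _ (interior_subset hy)]

end Threshold

end OptimalTiming

theorem mainTheorem8 {k : ℕ} {X : Set ℝ} {Y : Set (EuclideanSpace ℝ (Fin k))}
    (hX : Convex ℝ X) (hY : Convex ℝ Y) (hYm : MeasurableSet Y)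
    (F : Kernel Y (X × Y)) [IsMarkovKernel F]
    {Ω : Type*} {mΩ : MeasurableSpace Ω} (𝓕 : Filtration ℕ mΩ)
    (Z : ℕ → Ω → X × Y) (Pr : X × Y → Measure Ω)
    (hZ : OptimalTiming.IsMarkovFamily (OptimalTiming.transition F) 𝓕 Z Pr)
    (r : ℝ × EuclideanSpace ℝ (Fin k) → ℝ) (c : EuclideanSpace ℝ (Fin k) → ℝ)
    (hr : Measurable (OptimalTiming.exitPayoff X Y r)) (hc : Measurable fun y : Y => c y)
    (β : ℝ) (hβ₀ : 0 < β) (hβ₁ : β < 1)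
    (g : X × Y → ℝ) (n : ℕ) (m d m' d' : ℝ)
    (hdrift : OptimalTiming.DriftAssumption (OptimalTiming.transition F)
      (OptimalTiming.exitPayoff X Y r) (OptimalTiming.flowPayoff X Y c) β g n m d)
    (hweight : OptimalTiming.WeightAssumption (OptimalTiming.transition F)
      (OptimalTiming.exitPayoff X Y r) (OptimalTiming.flowPayoff X Y c) β n m d m' d')
    (f : X × Y → EuclideanSpace ℝ (Fin k) → ℝ)
    (hf : OptimalTiming.IsTransitionDensity F f)
    (hdens : OptimalTiming.DensityAssumption f)
    (hsmooth : OptimalTiming.SmoothnessAssumption f r c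
      (OptimalTiming.weight (OptimalTiming.transition F)
        (OptimalTiming.exitPayoff X Y r) (OptimalTiming.flowPayoff X Y c) g n m' d'))
    (ψ : EuclideanSpace ℝ (Fin k) → ℝ) (hψ : ψ = OptimalTiming.contValue 𝓕 Z Pr F r c β)
    (hthr : OptimalTiming.ThresholdAssumption X Y r ψ)
    (hrC1 : ContDiffOn ℝ 1 r (interior (X ×ˢ Y)))
    (xbar : EuclideanSpace ℝ (Fin k) → ℝ)
    (hxbar : OptimalTiming.IsDecisionThreshold X Y r ψ xbar)
    (hint : ∀ y ∈ interior Y, xbar y ∈ interior X)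
    (hDx : ∀ y ∈ interior Y, deriv (fun x => r (x, y)) (xbar y) ≠ 0) :
    ContDiffOn ℝ 1 xbar (interior Y) ∧
      ∀ y ∈ interior Y, ∀ i : Fin k,
        HasLineDerivAt ℝ xbar
          (-((OptimalTiming.partialDeriv i (fun u => r (xbar y, u)) y
              - OptimalTiming.partialDeriv i ψ y)
            / deriv (fun x => r (x, y)) (xbar y)))
          y (EuclideanSpace.single i 1) := by
  refine OptimalTiming.threshold_contDiffOn r ψ xbar ?_ hthr hrC1 hxbar hint hDx
  -- If `X` is empty, the indifference condition forces `Y` to be empty too.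
  rcases X.eq_empty_or_nonempty with rfl | hne
  · intro y hy
    obtain ⟨x, hx, -⟩ := hthr.indifference y (interior_subset hy)
    exact hx.elim
  rw [hψ]
  exact OptimalTiming.contDiffOn_contValue hX.ordConnected.measurableSet hYm hne F 𝓕 Z Pr hZ r c
    hr hc β hβ₀ hβ₁ g n m d m' d' hdrift hweight f hf hdens hsmooth
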